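/- Consider the linear model $y_i=Z_i\beta+\mathbf W_i^\top\gamma+\varepsilon_i$, $i=1,\dots,n$, with i.i.d. design vectors $X_i=(Z_i,\mathbf W_i^\top)^\top\sim\mathcal N_p(0,\Sigma)$, $Z_i\in\mathbb R$, $\mathbf W_i\in\mathbb R^{p-1}$, and i.i.d. errors $\varepsilon_i\sim\mathcal N(0,\sigma^2)$ independent of the design. Write $\theta=(\beta,\gamma,\Sigma,\sigma)$, $\Omega=\Sigma^{-1}$, and let $\mathbb E_\theta$ be the expectation under $\theta$ for the data $(y_i,Z_i,\mathbf W_i)_{i\le n}$. Fix constants $M>1$, $M_1,M_2>0$, $\zeta\in(M^{-1},1)$, $\kappa\in(0,\zeta M_1)$, $c<1/2$, $\alpha\in(0,1)$ and $\beta_0\in\mathbb R$. Let $\Theta$ be the set of all $\theta$ with $M^{-1}\le\lambda_{\min}(\Sigma)\le\lambda_{\max}(\Sigma)\le M$, $\Sigma_{(-1),(-1)}=\mathbb I_{p-1}$, $0\le\sigma\le M_1$ and $\|(\beta,\gamma^\top)^\top\|_2\le M_2$. Let $\Theta(s_0,b)$ be the set of $\theta\in\Theta$ with $\beta=b$ and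 at most $s_0$ nonzero entries in the first row of $\Omega$. For $h\ge0$ let $\Theta_{\zeta,\kappa}(s_0,\beta_0+h)$ be the set of all $\theta$ that belong to $\Theta(s_0,\beta_0+a)$ for some $0\le a\le h$ and satisfy $\|(\beta,\gamma^\top)^\top\|_2\le\zeta M_2$, $(\zeta M)^{-1}\le\lambda_{\min}(\Sigma)\le\lambda_{\max}(\Sigma)\le\zeta M$ and $\kappa\le\sigma\le\zeta M_1$. For a set $\Theta_1$ of parameters let $\Psi_\alpha(\Theta_1)$ be the set of measurable functions $\psi$ of the data with values in $[0,1]$ and $\sup_{\theta\in\Theta_1}\mathbb E_\theta\psi\le\alpha$. Let $p=p_n$ and $s=s_n$ be sequences of natural numbers such that, for all sufficiently large $n$, $s\,n^{-1}\log p\le 1/4$ and $2\le s\le p^{c}$. Put $h_n=\rho\, s\,n^{-1}\log p$, where $$\rho=\min\Bigl\{4,\ \tfrac{1/2-c}{15(\kappa^{-2}M+1)},\ \tfrac{2(\zeta^{-1}-1)^2}{M^3(2M+1)},\ \tfrac{2M(1-\zeta)^2}{2M+1},\ \tfrac{(1-\zeta^2)M_2}{8\zeta\sqrt M},\ \tfrac{\kappa^2(1-\zeta^2)^2M_2^2}{64\zeta^4MM_1^2},\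 \tfrac{M_2\sqrt{1-\zeta^2}}{2\sqrt M},\ \tfrac{\kappa^2(1-\zeta^2)M_2^2}{4\zeta^2M_1^2M}\Bigr\}.$$ Then $\Theta(s,\beta_0)$ is asymptotically uniformly non-testable against $\Theta_{\zeta,\kappa}(s/2,\beta_0+h_n)$ at size $\alpha$: for every sequence of tests $\psi_n\in\Psi_\alpha(\Theta(s,\beta_0))$, $\limsup_{n\to\infty}\sup_{\theta\in\Theta_{\zeta,\kappa}(s/2,\beta_0+h_n)}\mathbb E_\theta\psi_n\le\alpha$. Moreover $$\limsup_{n\to\infty}\ \sup_{\psi\in\Psi_\alpha(\Theta(s,\beta_0))}\ \sup_{\theta\in\Theta_{\zeta,\kappa}(s/2,\beta_0+h_n)}\mathbb E_\theta\psi\ \le\ \alpha,$$ with equality whenever $\Theta_{\zeta,\kappa}(s/2,\beta_0+h_n)$ is non-empty for infinitely many $n$. (Suprema over the empty set are $0$.) No sparsity of $\beta$ or $\gamma$ is assumed. -/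

import Mathlib

open MeasureTheory ProbabilityTheory Filter

noncomputable section

namespace UniformNonTestability

/-- The `p` coordinates of a design vector `X = (Z, W)` for `1 ≤ p`: the coordinate `Z` of interest
and the `p - 1` remaining coordinates `W`. -/
abbrev Coord (p : ℕ) : Type := Unit ⊕ Fin (p - 1)

/-- A parameter `θ = (β, γ, Σ, σ)` of the linear model with `p` covariates. -/
structure Param (p : ℕ) where
  /-- the coefficient `β` of `Z` -/
  beta : ℝ
  /-- the coefficients `γ` of `W` -/
  gamma : Fin (p - 1) → ℝ
  /-- the covariance matrix of the design vector -/
  Sigma : Matrix (Coord p) (Coord p) ℝ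
  /-- the standard deviation of the noise -/
  sigma : ℝ

namespace Param

variable {p : ℕ}

/-- The full coefficient vector `(β, γ)`, in Euclidean space. -/
def coef (θ : Param p) : EuclideanSpace ℝ (Coord p) :=
  WithLp.toLp 2 (Sum.elim (fun _ => θ.beta) θ.gamma)

/-- The number of nonzero entries of the first row of the precision matrix `Σ⁻¹`. -/
def rowSparsity (θ : Param p) : ℕ :=
  {j : Coord p | (θ.Sigma⁻¹) (Sum.inl ()) j ≠ 0}.ncard

end Param

/-- `S` is symmetric and `a ≤ λ_min(S) ≤ λ_max(S) ≤ b`. -/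
def EigenvaluesBetween {ι : Type*} [Fintype ι] [DecidableEq ι] (a b : ℝ) (S : Matrix ι ι ℝ) :
    Prop :=
  ∃ hS : S.IsHermitian, ∀ i, a ≤ hS.eigenvalues i ∧ hS.eigenvalues i ≤ b

/-- The parameter space `Θ`: eigenvalues of `Σ` in `[M⁻¹, M]`, uncorrelated standardized `W`,
noise level in `[0, M₁]`, and coefficient vector in the Euclidean ball of radius `M₂`. -/
def paramSpace (p : ℕ) (M M₁ M₂ : ℝ) : Set (Param p) :=
  {θ | EigenvaluesBetween M⁻¹ M θ.Sigma ∧ θ.Sigma.toBlocks₂₂ = 1 ∧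
    0 ≤ θ.sigma ∧ θ.sigma ≤ M₁ ∧ ‖θ.coef‖ ≤ M₂}

/-- The space `Θ(s₀, β₀)`. The sparsity bound `s₀` is real because `s / 2` occurs as a bound. -/
def nullSpace (p : ℕ) (M M₁ M₂ s₀ β₀ : ℝ) : Set (Param p) :=
  {θ | θ ∈ paramSpace p M M₁ M₂ ∧ θ.beta = β₀ ∧ (θ.rowSparsity : ℝ) ≤ s₀}

/-- The space `Θ_{ζ,κ}(s₀, β₀ + h)`. -/
def altSpace (p : ℕ) (M M₁ M₂ ζ κ s₀ β₀ h : ℝ) : Set (Param p) :=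
  {θ | (∃ a : ℝ, 0 ≤ a ∧ a ≤ h ∧ θ ∈ nullSpace p M M₁ M₂ s₀ (β₀ + a)) ∧
    ‖θ.coef‖ ≤ ζ * M₂ ∧ EigenvaluesBetween (ζ * M)⁻¹ (ζ * M) θ.Sigma ∧
    κ ≤ θ.sigma ∧ θ.sigma ≤ ζ * M₁}

/-- One observation `(y, X)` with `X = (Z, W)`. -/
abbrev Obs (p : ℕ) : Type := ℝ × EuclideanSpace ℝ (Coord p)

/-- The law of one observation under `θ`: `y = Z β + Wᵀ γ + ε`, where `X = (Z, W)` has law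
`N(0, Σ)` and the independent noise `ε` has law `N(0, σ²)`. -/
def obsLaw {p : ℕ} (θ : Param p) : Measure (Obs p) :=
  ((multivariateGaussian 0 θ.Sigma).prod (gaussianReal 0 (Real.toNNReal (θ.sigma ^ 2)))).map
    (fun u => (u.1 (Sum.inl ()) * θ.beta + ∑ j, u.1 (Sum.inr j) * θ.gamma j + u.2, u.1))

/-- The law of `n` i.i.d. observations under `θ`. -/
def dataLaw {p : ℕ} (n : ℕ) (θ : Param p) : Measure (Fin n → Obs p) :=
  Measure.pi (fun _ => obsLaw θ)

/-- The expectation `E_θ ψ` of a test `ψ` based on `n` observations. -/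
def power {p n : ℕ} (ψ : (Fin n → Obs p) → ℝ) (θ : Param p) : ℝ :=
  ∫ D, ψ D ∂(dataLaw n θ)

/-- The set `Ψ_α(Θ₁)` of (possibly randomized) tests of nominal level `α` based on `n`
observations. -/
def tests {p : ℕ} (n : ℕ) (α : ℝ) (Θ₁ : Set (Param p)) : Set ((Fin n → Obs p) → ℝ) :=
  {ψ | Measurable ψ ∧ (∀ D, 0 ≤ ψ D ∧ ψ D ≤ 1) ∧ ∀ θ ∈ Θ₁, power ψ θ ≤ α}

/-- Asymptotic uniform non-testability of the null hypotheses `Θ₁ n` against the alternatives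
`Θ₂ n` at size `α`. Powers lie in `[0, 1]`; the supremum over an empty alternative is `0`. -/
def AsympUniformlyNonTestable (α : ℝ) (p : ℕ → ℕ) (Θ₁ Θ₂ : (n : ℕ) → Set (Param (p n))) :
    Prop :=
  ∀ ψ : (n : ℕ) → (Fin n → Obs (p n)) → ℝ, (∀ n, ψ n ∈ tests n α (Θ₁ n)) →
    limsup (fun n => sSup {x : ℝ | ∃ θ ∈ Θ₂ n, x = power (ψ n) θ}) atTop ≤ α

/-- The supremum of `E_θ ψ` over all level-`α` tests `ψ` of `Θ₁` based on `n` observations and all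
`θ ∈ Θ₂` (`0` if `Θ₂` is empty). -/
def maxPower {p : ℕ} (n : ℕ) (α : ℝ) (Θ₁ Θ₂ : Set (Param p)) : ℝ :=
  sSup {x : ℝ | ∃ ψ ∈ tests n α Θ₁, ∃ θ ∈ Θ₂, x = power ψ θ}

/-- The constant `ρ`. -/
def rho (M M₁ M₂ ζ κ c : ℝ) : ℝ :=
  min 4 <|
  min ((1 / 2 - c) / (15 * ((κ ^ 2)⁻¹ * M + 1))) <|
  min (2 * (ζ⁻¹ - 1) ^ 2 / (M ^ 3 * (2 * M + 1))) <|
  min (2 * M * (1 - ζ) ^ 2 / (2 * M + 1)) <|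
  min ((1 - ζ ^ 2) * M₂ / (8 * ζ * √M)) <|
  min (κ ^ 2 * (1 - ζ ^ 2) ^ 2 * M₂ ^ 2 / (64 * ζ ^ 4 * M * M₁ ^ 2)) <|
  min (M₂ * √(1 - ζ ^ 2) / (2 * √M))
    (κ ^ 2 * (1 - ζ ^ 2) * M₂ ^ 2 / (4 * ζ ^ 2 * M₁ ^ 2 * M))

/-- The detection radius `h_n = ρ s log p / n`. -/
def radius (M M₁ M₂ ζ κ c : ℝ) (s p n : ℕ) : ℝ :=
  rho M M₁ M₂ ζ κ c * (s * Real.log p / n)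

end UniformNonTestability

end

noncomputable section

namespace UniformNonTestability

open scoped RealInnerProductSpace Topology

/-! ### Second moment method for mixtures of product laws -/

section SecondMoment

variable {Ω : Type*} [MeasurableSpace Ω]

/-! Fix an alternative with β = β₀ + a. Let τ be the variance of Z, π its covariances with W, and v
= τ - ‖π‖² its residual variance given W. Given W, the residuals of Z and of y - β₀Z have variances
v and a²v + σ² and covariance av. A null parameter reproduces these numbers if both residuals share
a hidden component ⟨ξ, W⟩ with ξ ⊥ π and ‖ξ‖² = av: replace π by π + ξ, γ by γ + aπ + ξ and σ² by σ²
- a(1 - a)v. As γ need not be sparse, it is free to absorb this change.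

Only the correlation with W along ξ then separates null from alternative. It is hidden by drawing ξ
at random, with one nonzero entry in each of m = ⌊s/2⌋ disjoint blocks of L = ⌊p/(2m)⌋ coordinates
at which π vanishes. The alternative uses at most s/2 of the row sparsity, so the null parameters
stay within s.

The alternative and all these null parameters are images, under one linear map, of a standard
Gaussian law and of tilts of it (`obsLaw_eq_map_of_untilted`, `obsLaw_eq_map_of_tilted_covariates`).
The product of two tilt densities has mean 1 / (1 - ⟪δ, η⟫) (`integral_tiltDensity_mul`). By
`abs_average_integral_pi_sub_le`, the gap between the power at the alternative and the average null
power, which is at most α, is controlled by an average of exp(x · agreement), itself at most exp(m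
eˣ / L) (`average_exp_agreement_le`). The choice of ρ gives eˣ ≤ p^(1/2 - c), while m / L ≤ p^(2c -
1); hence m eˣ / L ≤ p^(-(1/2 - c)), which is small for large p.

The dimension need not tend to infinity. For p ≤ P one has a = O(1/n), far below the parametric
rate, and a single null parameter with the same design and noise variance σ² + a²v suffices
(`power_le_of_tilted_noise`). `eventually_power_le` combines the two regimes, with P depending on ε.
Equality comes from the constant test α. -/

lemma pi_withDensity {n : ℕ} (Q : Measure Ω) [IsProbabilityMeasure Q] {f : Ω → ℝ}
    (h0 : ∀ x, 0 ≤ f x) (hi : Integrable f Q) :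
    Measure.pi (fun _ : Fin n => Q.withDensity (fun x => ENNReal.ofReal (f x))) =
      (Measure.pi fun _ : Fin n => Q).withDensity
        (fun x => ENNReal.ofReal (∏ i, f (x i))) := by
  have : IsFiniteMeasure (Q.withDensity (fun x => ENNReal.ofReal (f x))) :=
    isFiniteMeasure_withDensity_ofReal hi.2
  refine Measure.pi_eq fun s hs => ?_
  have hS : MeasurableSet (Set.univ.pi s) := MeasurableSet.univ_pi hs
  have hind : ∀ i, Integrable ((s i).indicator f) Q := fun i => hi.indicator (hs i)
  have hnn : ∀ i x, 0 ≤ (s i).indicator f x := fun i x => Set.indicator_nonneg (fun y _ => h0 y) x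
  have e1 : ∀ i, Q.withDensity (fun x => ENNReal.ofReal (f x)) (s i) =
      ENNReal.ofReal (∫ x, (s i).indicator f x ∂Q) := by
    intro i
    rw [withDensity_apply _ (hs i), ofReal_integral_eq_lintegral_ofReal (hind i)
      (ae_of_all _ (hnn i)), ← lintegral_indicator (hs i)]
    refine lintegral_congr fun x => ?_
    by_cases hx : x ∈ s i <;> simp [hx]
  rw [withDensity_apply _ hS, ← lintegral_indicator hS]
  simp_rw [e1]
  rw [← ENNReal.ofReal_prod_of_nonneg (fun i _ => integral_nonneg (hnn i)),
    ← integral_fintype_prod_eq_prod (fun i => (s i).indicator f),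
    ofReal_integral_eq_lintegral_ofReal (Integrable.fintype_prod hind)
      (ae_of_all _ fun x => Finset.prod_nonneg fun i _ => hnn i _)]
  refine lintegral_congr fun x => ?_
  by_cases hx : x ∈ Set.univ.pi s
  · rw [Set.indicator_of_mem hx]
    congr 1
    exact Finset.prod_congr rfl fun i _ => (Set.indicator_of_mem (hx i trivial) _).symm
  · rw [Set.indicator_of_notMem hx]
    simp only [Set.mem_pi, Set.mem_univ, true_implies, not_forall] at hx
    obtain ⟨i, hi⟩ := hx
    rw [Finset.prod_eq_zero (Finset.mem_univ i) (Set.indicator_of_notMem hi _)]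
    simp

/-- As 0 ≤ φ ≤ 1, only the L¹ norm of L - 1 matters. It is at most the L² norm, whose square is the
chi-square divergence ∫ L² - 1. -/
lemma abs_integral_sub_le_sqrt (P : Measure Ω) [IsProbabilityMeasure P] {L φ : Ω → ℝ} {V : ℝ}
    (hL : MemLp L 2 P) (hL1 : ∫ x, L x ∂P = 1) (hV : ∫ x, L x ^ 2 ∂P ≤ V) (hφ : Measurable φ)
    (hφ01 : ∀ x, 0 ≤ φ x ∧ φ x ≤ 1) :
    |∫ x, L x * φ x ∂P - ∫ x, φ x ∂P| ≤ √(V - 1) := by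
  have hLi : Integrable L P := hL.integrable (by norm_num)
  have hφi : Integrable φ P := Integrable.of_bound hφ.aestronglyMeasurable 1
    (ae_of_all _ fun x => by
      rw [Real.norm_eq_abs, abs_le]; constructor <;> linarith [hφ01 x])
  have hLφ : Integrable (fun x => L x * φ x) P :=
    hLi.mul_bdd (c := 1) hφ.aestronglyMeasurable (ae_of_all _ fun x => by
      rw [Real.norm_eq_abs, abs_le]; constructor <;> linarith [hφ01 x])
  rw [← integral_sub hLφ hφi]
  have hd : MemLp (fun x => L x - 1) 2 P := hL.sub (memLp_const 1)
  have hda : MemLp (fun x => |L x - 1|) 2 P := hd.abs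
  have h1 : |∫ x, L x * φ x - φ x ∂P| ≤ ∫ x, |L x - 1| ∂P := by
    refine abs_integral_le_integral_abs.trans ?_
    refine integral_mono (hLφ.sub hφi).abs (hda.integrable (by norm_num)) fun x => ?_
    have : L x * φ x - φ x = (L x - 1) * φ x := by ring
    simp only [this, abs_mul]
    calc |L x - 1| * |φ x| ≤ |L x - 1| * 1 := by
          gcongr; rw [abs_le]; constructor <;> linarith [hφ01 x]
      _ = _ := mul_one _
  -- Cauchy–Schwarz in the form: the variance of |L - 1| is nonnegative.
  have h2 : (∫ x, |L x - 1| ∂P) ^ 2 ≤ V - 1 := by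
    have h3 := variance_nonneg (fun x => |L x - 1|) P
    rw [variance_eq_sub hda] at h3
    have h4 : ∫ x, ((fun x => |L x - 1|) ^ 2) x ∂P = ∫ x, (L x ^ 2 - 2 * L x + 1) ∂P := by
      refine integral_congr_ae (ae_of_all _ fun x => ?_)
      simp only [Pi.pow_apply, sq_abs]; ring
    have h5 : ∫ x, (L x ^ 2 - 2 * L x + 1) ∂P = ∫ x, L x ^ 2 ∂P - 1 := by
      have hq : Integrable (fun x => L x ^ 2 - 2 * L x) P :=
        hL.integrable_sq.sub (hLi.const_mul 2)
      rw [integral_add hq (integrable_const _),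
        integral_sub hL.integrable_sq (hLi.const_mul 2), integral_const_mul, hL1]
      simp; ring
    rw [h4, h5] at h3
    linarith
  exact h1.trans (Real.le_sqrt_of_sq_le h2)

/-- Second moment method: the average of the `n`-fold products of laws with densities `f j`
is close in total variation to the `n`-fold product of the reference law. -/
theorem abs_average_integral_pi_sub_le (Q : Measure Ω) [IsProbabilityMeasure Q] {J : Type*}
    [Fintype J] [Nonempty J] (n : ℕ) {f : J → Ω → ℝ} {K : J → J → ℝ}
    (h0 : ∀ j x, 0 ≤ f j x) (h1 : ∀ j, ∫ x, f j x ∂Q = 1)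
    (h2 : ∀ j, MemLp (f j) 2 Q) (hK : ∀ j k, ∫ x, f j x * f k x ∂Q ≤ K j k)
    {φ : (Fin n → Ω) → ℝ} (hφ : Measurable φ) (hφ01 : ∀ x, 0 ≤ φ x ∧ φ x ≤ 1) :
    |(∑ j, ∫ x, φ x ∂(Measure.pi fun _ : Fin n =>
        Q.withDensity (fun x => ENNReal.ofReal (f j x)))) / Fintype.card J
      - ∫ x, φ x ∂(Measure.pi fun _ : Fin n => Q)| ≤
      √((∑ j, ∑ k, K j k ^ n) / (Fintype.card J : ℝ) ^ 2 - 1) := by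
  set P := Measure.pi fun _ : Fin n => Q
  set N : ℝ := (Fintype.card J : ℝ)
  have hN : 0 < N := by simp only [N]; exact_mod_cast Fintype.card_pos
  have hi : ∀ j, Integrable (f j) Q := fun j => (h2 j).integrable (by norm_num)
  have hFi : ∀ j, Integrable (fun x : Fin n → Ω => ∏ i, f j (x i)) P := fun j =>
    Integrable.fintype_prod fun _ => hi j
  have hFFi : ∀ j k, Integrable (fun x : Fin n → Ω => (∏ i, f j (x i)) * ∏ i, f k (x i)) P := by
    intro j k
    simp_rw [← Finset.prod_mul_distrib]
    exact Integrable.fintype_prod (f := fun _ x => f j x * f k x)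
      fun _ => (h2 j).integrable_mul (h2 k)
  have hF0 : ∀ j (x : Fin n → Ω), 0 ≤ ∏ i, f j (x i) := fun j x =>
    Finset.prod_nonneg fun i _ => h0 j _
  have hF2 : ∀ j, MemLp (fun x : Fin n → Ω => ∏ i, f j (x i)) 2 P := by
    intro j
    rw [memLp_two_iff_integrable_sq (hFi j).aestronglyMeasurable]
    simpa only [sq] using hFFi j j
  have hF1 : ∀ j, ∫ x : Fin n → Ω, ∏ i, f j (x i) ∂P = 1 := by
    intro j
    rw [integral_fintype_prod_eq_prod (fun _ => f j)]
    simp [h1]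
  set L : (Fin n → Ω) → ℝ := fun x => N⁻¹ * ∑ j, ∏ i, f j (x i)
  have hL2 : MemLp L 2 P := (memLp_finsetSum _ fun j _ => hF2 j).const_mul _
  have hL1 : ∫ x, L x ∂P = 1 := by
    simp only [L]
    rw [integral_const_mul, integral_finsetSum _ fun j _ => hFi j]
    simp only [hF1, Finset.sum_const, Finset.card_univ, nsmul_eq_mul, mul_one]
    exact inv_mul_cancel₀ hN.ne'
  have hV : ∫ x, L x ^ 2 ∂P ≤ (∑ j, ∑ k, K j k ^ n) / N ^ 2 := by
    have : ∀ x, L x ^ 2 = (N ^ 2)⁻¹ * ∑ j, ∑ k, (∏ i, f j (x i)) * ∏ i, f k (x i) := by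
      intro x
      simp only [L]
      rw [mul_pow, inv_pow, sq (∑ j, _), Finset.sum_mul_sum]
    simp_rw [this]
    rw [integral_const_mul, integral_finsetSum _ fun j _ =>
      integrable_finsetSum _ fun k _ => hFFi j k, div_eq_inv_mul]
    gcongr with j _
    rw [integral_finsetSum _ fun k _ => hFFi j k]
    gcongr with k _
    simp_rw [← Finset.prod_mul_distrib]
    rw [integral_fintype_prod_eq_prod (fun _ x => f j x * f k x)]
    simp only [Finset.prod_const, Finset.card_univ, Fintype.card_fin]
    exact pow_le_pow_left₀ (integral_nonneg fun x => mul_nonneg (h0 j x) (h0 k x)) (hK j k) n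
  have hmain := abs_integral_sub_le_sqrt P hL2 hL1 hV hφ hφ01
  have hφF : ∀ j, Integrable (fun x : Fin n → Ω => (∏ i, f j (x i)) * φ x) P := fun j =>
    (hFi j).mul_bdd (c := 1) hφ.aestronglyMeasurable (ae_of_all _ fun x => by
      rw [Real.norm_eq_abs, abs_le]; constructor <;> linarith [hφ01 x])
  convert hmain using 3
  simp only [L]
  simp_rw [mul_assoc, Finset.sum_mul]
  rw [integral_const_mul, integral_finsetSum _ fun j _ => hφF j, div_eq_inv_mul]
  congr 1
  refine Finset.sum_congr rfl fun j _ => ?_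
  rw [pi_withDensity Q (h0 j) (hi j), integral_withDensity_eq_integral_toReal_smul₀]
  · refine integral_congr_ae (ae_of_all _ fun x => ?_)
    simp [ENNReal.toReal_ofReal (hF0 j x)]
  · exact (hFi j).aestronglyMeasurable.aemeasurable.ennreal_ofReal
  · exact ae_of_all _ fun x => ENNReal.ofReal_lt_top

end SecondMoment

/-! ### Gaussian tilts and their second moments -/

section Tilting

/-- The density of `N(m, v)` with respect to `N(0, 1)`. -/
def gaussianRatio (m v x : ℝ) : ℝ := (√v)⁻¹ * Real.exp (x ^ 2 / 2 - (x - m) ^ 2 / (2 * v))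

lemma gaussianRatio_nonneg (m v x : ℝ) : 0 ≤ gaussianRatio m v x := by
  unfold gaussianRatio; positivity

lemma gaussianReal_eq_withDensity_gaussianRatio (m : ℝ) {v : ℝ} (hv : 0 < v) :
    gaussianReal m v.toNNReal =
      (gaussianReal 0 1).withDensity (fun x => ENNReal.ofReal (gaussianRatio m v x)) := by
  have hv' : v.toNNReal ≠ 0 := by simpa using hv
  rw [gaussianReal_of_var_ne_zero _ hv', gaussianReal_of_var_ne_zero _ one_ne_zero,
    ← withDensity_mul _ (measurable_gaussianPDF 0 1)
      (by unfold gaussianRatio; fun_prop)]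
  congr 1
  ext x
  rw [Pi.mul_apply, gaussianPDF_def, gaussianPDF_def, ← ENNReal.ofReal_mul
    (gaussianPDFReal_nonneg _ _ _), gaussianPDFReal_def, gaussianPDFReal_def]
  simp only [gaussianRatio, Real.coe_toNNReal _ hv.le, NNReal.coe_one]
  rw [mul_mul_mul_comm, ← Real.exp_add, Real.sqrt_mul (by positivity), mul_one, mul_inv]
  congr 2
  ring_nf

lemma lintegral_gaussianRatio (m : ℝ) {v : ℝ} (hv : 0 < v) :
    ∫⁻ x, ENNReal.ofReal (gaussianRatio m v x) ∂(gaussianReal 0 1) = 1 := by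
  have := measure_univ (μ := gaussianReal m v.toNNReal)
  rwa [gaussianReal_eq_withDensity_gaussianRatio m hv, withDensity_apply _ MeasurableSet.univ,
    Measure.restrict_univ] at this

/-- Completing the square turns the integrand into a constant times the density of N(b / (1 - 2t), 1
/ (1 - 2t)), which has mass one. -/
lemma lintegral_exp_quadratic (b : ℝ) {t : ℝ} (ht : t < 1 / 2) :
    ∫⁻ x, ENNReal.ofReal (Real.exp (t * x ^ 2 + b * x)) ∂(gaussianReal 0 1) =
      ENNReal.ofReal ((√(1 - 2 * t))⁻¹ * Real.exp (b ^ 2 / (2 * (1 - 2 * t)))) := by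
  have h : 0 < 1 - 2 * t := by linarith
  have hv : 0 < (1 - 2 * t)⁻¹ := inv_pos.mpr h
  set C := (√(1 - 2 * t))⁻¹ * Real.exp (b ^ 2 / (2 * (1 - 2 * t)))
  have hC : 0 ≤ C := by positivity
  have key : ∀ x, Real.exp (t * x ^ 2 + b * x) =
      C * gaussianRatio (b * (1 - 2 * t)⁻¹) (1 - 2 * t)⁻¹ x := by
    intro x
    simp only [C, gaussianRatio]
    rw [mul_mul_mul_comm, ← Real.exp_add, Real.sqrt_inv, inv_inv,
      inv_mul_cancel₀ (Real.sqrt_pos.mpr h).ne', one_mul]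
    congr 1
    obtain ⟨d, hd⟩ : ∃ d, d = 1 - 2 * t := ⟨_, rfl⟩
    have ht' : t = (1 - d) / 2 := by rw [hd]; ring
    rw [← hd] at h ⊢
    rw [ht']
    field_simp
    ring
  simp_rw [key, ENNReal.ofReal_mul hC]
  rw [lintegral_const_mul _ (by unfold gaussianRatio; fun_prop), lintegral_gaussianRatio _ hv,
    mul_one]

lemma lintegral_exp_sq_gaussianReal {t v : ℝ} (hv : 0 ≤ v) (ht : t * v < 1 / 2) :
    ∫⁻ x, ENNReal.ofReal (Real.exp (t * x ^ 2)) ∂(gaussianReal 0 v.toNNReal) =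
      ENNReal.ofReal ((√(1 - 2 * (t * v)))⁻¹) := by
  have e : gaussianReal 0 v.toNNReal = (gaussianReal 0 1).map (fun x => √v * x) := by
    rw [gaussianReal_map_const_mul, mul_zero, mul_one]
    congr 1
    ext
    simp [Real.sq_sqrt hv, Real.coe_toNNReal _ hv]
  rw [e, lintegral_map (by fun_prop) (by fun_prop)]
  have := lintegral_exp_quadratic 0 ht
  simp only [zero_mul, add_zero, ne_eq, OfNat.ofNat_ne_zero, not_false_eq_true, zero_pow,
    zero_div, Real.exp_zero, mul_one] at this
  rw [← this]
  refine lintegral_congr fun x => ?_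
  rw [mul_pow, Real.sq_sqrt hv, mul_assoc]

variable {E : Type*} [NormedAddCommGroup E] [InnerProductSpace ℝ E] [FiniteDimensional ℝ E]
  [MeasurableSpace E] [BorelSpace E]

lemma map_inner_stdGaussian (a : E) :
    (stdGaussian E).map (fun w => ⟪a, w⟫) = gaussianReal 0 (‖a‖ ^ 2).toNNReal := by
  have := IsGaussian.map_eq_gaussianReal (μ := stdGaussian E) (innerSL ℝ a)
  rw [integral_strongDual_stdGaussian, variance_dual_stdGaussian, innerSL_apply_norm] at this
  exact this

lemma indepFun_inner_stdGaussian {a b : E} (hab : ⟪a, b⟫ = 0) :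
    (fun w => ⟪a, w⟫) ⟂ᵢ[stdGaussian E] (fun w => ⟪b, w⟫) := by
  refine HasGaussianLaw.indepFun_of_covariance_eq_zero ?_ ?_
  · exact (IsGaussian.hasGaussianLaw_id (μ := stdGaussian E)).map_fun
      ((innerSL ℝ a).prod (innerSL ℝ b))
  · rw [← covarianceBilin_apply_eq_cov IsGaussian.memLp_two_id, covarianceBilin_stdGaussian]
    exact hab

lemma lintegral_exp_sq_add_sq_stdGaussian {a b : E} (hab : ⟪a, b⟫ = 0) {s t : ℝ}
    (hs : s * ‖a‖ ^ 2 < 1 / 2) (ht : t * ‖b‖ ^ 2 < 1 / 2) :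
    ∫⁻ w, ENNReal.ofReal (Real.exp (s * ⟪a, w⟫ ^ 2 + t * ⟪b, w⟫ ^ 2)) ∂(stdGaussian E) =
      ENNReal.ofReal ((√(1 - 2 * (s * ‖a‖ ^ 2)))⁻¹ * (√(1 - 2 * (t * ‖b‖ ^ 2)))⁻¹) := by
  simp_rw [Real.exp_add, ENNReal.ofReal_mul (Real.exp_nonneg _)]
  have hind := (indepFun_inner_stdGaussian hab).comp
    (φ := fun x => ENNReal.ofReal (Real.exp (s * x ^ 2)))
    (ψ := fun x => ENNReal.ofReal (Real.exp (t * x ^ 2))) (by fun_prop) (by fun_prop)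
  have := lintegral_mul_eq_lintegral_mul_lintegral_of_indepFun'' (by fun_prop) (by fun_prop) hind
  simp only [Function.comp_def] at this
  rw [this, ENNReal.ofReal_mul (by positivity), ← lintegral_exp_sq_gaussianReal (by positivity) hs,
    ← lintegral_exp_sq_gaussianReal (by positivity) ht, ← map_inner_stdGaussian a,
    ← map_inner_stdGaussian b, lintegral_map (by fun_prop) (by fun_prop),
    lintegral_map (by fun_prop) (by fun_prop)]

variable (E) in
/-- The law of a standard Gaussian vector together with an independent standard normal variable. -/
def refLaw : Measure (E × ℝ) := (stdGaussian E).prod (gaussianReal 0 1)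

instance : IsProbabilityMeasure (refLaw E) := by unfold refLaw; infer_instance

/-- The density with respect to `refLaw E` of the law of `(w, g)` in which `w` is standard Gaussian
and `g` is `N(⟪δ, w⟫, 1 - ‖δ‖ ^ 2)` given `w`. -/
def tiltDensity (δ : E) (u : E × ℝ) : ℝ := gaussianRatio ⟪δ, u.1⟫ (1 - ‖δ‖ ^ 2) u.2

omit [FiniteDimensional ℝ E] [MeasurableSpace E] [BorelSpace E] in
lemma tiltDensity_nonneg (δ : E) (u : E × ℝ) : 0 ≤ tiltDensity δ u := gaussianRatio_nonneg _ _ _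

@[fun_prop]
lemma measurable_tiltDensity (δ : E) : Measurable (tiltDensity δ) := by
  unfold tiltDensity gaussianRatio; fun_prop

lemma lintegral_tiltDensity {δ : E} (hδ : ‖δ‖ ^ 2 < 1) :
    ∫⁻ u, ENNReal.ofReal (tiltDensity δ u) ∂(refLaw E) = 1 := by
  rw [refLaw, lintegral_prod _ (by fun_prop)]
  simp only [tiltDensity]
  simp_rw [lintegral_gaussianRatio _ (sub_pos.mpr hδ)]
  simp

lemma integral_tiltDensity {δ : E} (hδ : ‖δ‖ ^ 2 < 1) :
    ∫ u, tiltDensity δ u ∂(refLaw E) = 1 := by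
  rw [integral_eq_lintegral_of_nonneg_ae (ae_of_all _ (tiltDensity_nonneg δ))
    (by fun_prop), lintegral_tiltDensity hδ, ENNReal.toReal_one]

/-- Integrating out the real variable leaves the exponential of a quadratic form in ⟪δ + η, w⟫ and
⟪δ - η, w⟫. Equal norms make δ + η and δ - η orthogonal, so these are independent and the integral
factors. The `lintegral` form also yields square integrability of the densities. -/
lemma lintegral_tiltDensity_mul {δ η : E} {r : ℝ} (hr : r < 1) (hδ : ‖δ‖ ^ 2 = r)
    (hη : ‖η‖ ^ 2 = r) :
    ∫⁻ u, ENNReal.ofReal (tiltDensity δ u * tiltDensity η u) ∂(refLaw E) =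
      ENNReal.ofReal (1 / (1 - ⟪δ, η⟫)) := by
  have hr0 : 0 ≤ r := hδ ▸ sq_nonneg _
  have hinner : |⟪δ, η⟫| ≤ r := by
    have h1 := abs_real_inner_le_norm δ η
    nlinarith [sq_nonneg (‖δ‖ - ‖η‖)]
  obtain ⟨hi1, hi2⟩ := abs_le.mp hinner
  set ρ := ⟪δ, η⟫ with hρ
  have hadd : ‖δ + η‖ ^ 2 = 2 * (r + ρ) := by
    rw [norm_add_sq_real, hδ, hη]; ring
  have hsub : ‖δ - η‖ ^ 2 = 2 * (r - ρ) := by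
    rw [norm_sub_sq_real, hδ, hη]; ring
  have horth : ⟪δ + η, δ - η⟫ = 0 := by
    rw [inner_add_left, inner_sub_right, inner_sub_right, real_inner_self_eq_norm_sq,
      real_inner_self_eq_norm_sq, real_inner_comm δ η, hδ, hη]; ring
  have h1r : 0 < 1 - r := by linarith
  have h1r' : 0 < 1 + r := by linarith
  have hρ1 : 0 < 1 - ρ := by linarith
  set C := (1 - r)⁻¹ * (√(1 - 2 * (-r / (1 - r))))⁻¹ with hC
  have hC0 : 0 ≤ C := by positivity
  rw [refLaw, lintegral_prod _ (by fun_prop)]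
  have inner_eq : ∀ w : E, ∫⁻ g, ENNReal.ofReal (tiltDensity δ (w, g) * tiltDensity η (w, g))
      ∂(gaussianReal 0 1) = ENNReal.ofReal C * ENNReal.ofReal (Real.exp
        ((4 * (1 + r))⁻¹ * ⟪δ + η, w⟫ ^ 2 + (-(4 * (1 - r))⁻¹) * ⟪δ - η, w⟫ ^ 2)) := by
    intro w
    set m := ⟪δ, w⟫
    set k := ⟪η, w⟫
    have e1 : ∀ g, tiltDensity δ (w, g) * tiltDensity η (w, g) =
        ((1 - r)⁻¹ * Real.exp (-(m ^ 2 + k ^ 2) / (2 * (1 - r)))) *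
          Real.exp (-r / (1 - r) * g ^ 2 + (m + k) / (1 - r) * g) := by
      intro g
      simp only [tiltDensity, gaussianRatio, hδ, hη]
      rw [mul_mul_mul_comm, ← Real.exp_add, ← mul_inv, Real.mul_self_sqrt h1r.le, mul_assoc,
        ← Real.exp_add]
      congr 2
      simp only [m, k]
      field_simp
      ring
    simp_rw [e1, ENNReal.ofReal_mul (show 0 ≤ (1 - r)⁻¹ *
      Real.exp (-(m ^ 2 + k ^ 2) / (2 * (1 - r))) by positivity)]
    rw [lintegral_const_mul _ (by fun_prop), lintegral_exp_quadratic _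
      (show -r / (1 - r) < 1 / 2 from
        (div_nonpos_of_nonpos_of_nonneg (by linarith) h1r.le).trans_lt (by norm_num)),
      ← ENNReal.ofReal_mul (by positivity), ← ENNReal.ofReal_mul hC0]
    congr 1
    rw [hC, mul_mul_mul_comm, ← Real.exp_add]
    congr 2
    rw [inner_add_left, inner_sub_left]
    have : 1 - 2 * (-r / (1 - r)) = (1 + r) / (1 - r) := by field_simp; ring
    rw [this]
    simp only [m, k]
    field_simp
    ring
  simp_rw [inner_eq]
  rw [lintegral_const_mul _ (by fun_prop), lintegral_exp_sq_add_sq_stdGaussian horth,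
    ← ENNReal.ofReal_mul hC0]
  · congr 1
    rw [hC, hadd, hsub]
    have e1 : 1 - 2 * (-r / (1 - r)) = (1 + r) / (1 - r) := by field_simp; ring
    have e2 : 1 - 2 * ((4 * (1 + r))⁻¹ * (2 * (r + ρ))) = (1 - ρ) / (1 + r) := by
      field_simp; ring
    have e3 : 1 - 2 * (-(4 * (1 - r))⁻¹ * (2 * (r - ρ))) = (1 - ρ) / (1 - r) := by
      field_simp; ring
    rw [e1, e2, e3, Real.sqrt_div h1r'.le, Real.sqrt_div hρ1.le, Real.sqrt_div hρ1.le]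
    have s1 := Real.sqrt_pos.mpr h1r
    have s2 := Real.sqrt_pos.mpr h1r'
    have s3 := Real.sqrt_pos.mpr hρ1
    field_simp
    rw [Real.sq_sqrt h1r.le, Real.sq_sqrt hρ1.le]
  · rw [hadd, inv_mul_lt_iff₀ (by positivity)]; linarith
  · rw [hsub]
    have : -(4 * (1 - r))⁻¹ * (2 * (r - ρ)) ≤ 0 :=
      mul_nonpos_of_nonpos_of_nonneg (by simp; linarith) (by linarith)
    linarith

lemma integral_tiltDensity_mul {δ η : E} {r : ℝ} (hr : r < 1) (hδ : ‖δ‖ ^ 2 = r)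
    (hη : ‖η‖ ^ 2 = r) :
    ∫ u, tiltDensity δ u * tiltDensity η u ∂(refLaw E) = 1 / (1 - ⟪δ, η⟫) := by
  rw [integral_eq_lintegral_of_nonneg_ae
    (ae_of_all _ fun u => mul_nonneg (tiltDensity_nonneg δ u) (tiltDensity_nonneg η u))
    (by fun_prop), lintegral_tiltDensity_mul hr hδ hη, ENNReal.toReal_ofReal]
  have h1 := real_inner_le_norm δ η
  have : ⟪δ, η⟫ ≤ r := by nlinarith [sq_nonneg (‖δ‖ - ‖η‖)]
  exact one_div_nonneg.mpr (by linarith)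

lemma memLp_two_tiltDensity {δ : E} (hδ : ‖δ‖ ^ 2 < 1) : MemLp (tiltDensity δ) 2 (refLaw E) := by
  rw [memLp_two_iff_integrable_sq (by fun_prop)]
  refine ⟨by fun_prop, ?_⟩
  rw [hasFiniteIntegral_iff_ofReal (ae_of_all _ fun u => sq_nonneg _)]
  simp_rw [sq]
  rw [lintegral_tiltDensity_mul hδ rfl rfl]
  exact ENNReal.ofReal_lt_top

lemma norm_cexp_ofReal_mul_I_le (x : ℝ) : ‖Complex.exp (x * Complex.I)‖ ≤ 1 :=
  (Complex.norm_exp_ofReal_mul_I x).le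

/-- The law with density `tiltDensity δ`. -/
def tiltLaw (δ : E) : Measure (E × ℝ) :=
  (refLaw E).withDensity (fun u => ENNReal.ofReal (tiltDensity δ u))

lemma isProbabilityMeasure_tiltLaw {δ : E} (hδ : ‖δ‖ ^ 2 < 1) :
    IsProbabilityMeasure (tiltLaw δ) := by
  refine ⟨?_⟩
  rw [tiltLaw, withDensity_apply _ MeasurableSet.univ, Measure.restrict_univ,
    lintegral_tiltDensity hδ]

omit [BorelSpace E] in
lemma tiltLaw_zero : tiltLaw (0 : E) = refLaw E := by
  simp [tiltLaw, tiltDensity, gaussianRatio]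

lemma integral_cexp_stdGaussian (a : E) :
    ∫ w, Complex.exp (((⟪a, w⟫ : ℝ) : ℂ) * Complex.I) ∂(stdGaussian E) =
      Complex.exp (-((‖a‖ ^ 2 : ℝ) : ℂ) / 2) := by
  have := charFun_stdGaussian a
  rw [charFun_apply] at this
  simp_rw [real_inner_comm a] at this
  rw [this]; push_cast; rfl

/-- Under the tilt, (w, g) is still centred Gaussian with standard marginals; only the covariance δ
of g with w is new. This is its characteristic function. -/
lemma integral_cexp_tiltLaw {δ : E} (hδ : ‖δ‖ ^ 2 < 1) (c : E) (s : ℝ) :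
    ∫ u, Complex.exp (((⟪c, u.1⟫ + s * u.2 : ℝ) : ℂ) * Complex.I) ∂(tiltLaw δ) =
      Complex.exp (-((s ^ 2 + ‖c‖ ^ 2 + 2 * s * ⟪δ, c⟫ : ℝ) : ℂ) / 2) := by
  have hv : 0 < 1 - ‖δ‖ ^ 2 := sub_pos.mpr hδ
  have hint : Integrable (tiltDensity δ) (refLaw E) :=
    (memLp_two_tiltDensity hδ).integrable (by norm_num)
  rw [tiltLaw, integral_withDensity_eq_integral_toReal_smul₀ (by fun_prop)
    (ae_of_all _ fun _ => ENNReal.ofReal_lt_top)]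
  have hint2 : Integrable (fun u : E × ℝ => (ENNReal.ofReal (tiltDensity δ u)).toReal •
      Complex.exp (((⟪c, u.1⟫ + s * u.2 : ℝ) : ℂ) * Complex.I)) (refLaw E) := by
    simp_rw [ENNReal.toReal_ofReal (tiltDensity_nonneg δ _)]
    refine hint.smul_bdd (C := 1) (by fun_prop)
      (ae_of_all _ fun u => norm_cexp_ofReal_mul_I_le _)
  rw [refLaw] at hint2 ⊢
  rw [integral_prod _ hint2]
  -- Given w, the mean ⟪δ, w⟫ of g moves the frequency c to c + sδ.
  have inner_eq : ∀ w : E, ∫ g, (ENNReal.ofReal (tiltDensity δ (w, g))).toReal •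
      Complex.exp (((⟪c, w⟫ + s * g : ℝ) : ℂ) * Complex.I) ∂(gaussianReal 0 1) =
      Complex.exp (-(((1 - ‖δ‖ ^ 2) * s ^ 2 : ℝ) : ℂ) / 2) *
        Complex.exp (((⟪c + s • δ, w⟫ : ℝ) : ℂ) * Complex.I) := by
    intro w
    have h1 := charFun_gaussianReal (μ := ⟪δ, w⟫) (v := (1 - ‖δ‖ ^ 2).toNNReal) s
    rw [charFun_apply_real, gaussianReal_eq_withDensity_gaussianRatio _ hv,
      integral_withDensity_eq_integral_toReal_smul₀ (by unfold gaussianRatio; fun_prop)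
      (ae_of_all _ fun _ => ENNReal.ofReal_lt_top)] at h1
    have h2 : ∀ g : ℝ, (ENNReal.ofReal (tiltDensity δ (w, g))).toReal •
      Complex.exp (((⟪c, w⟫ + s * g : ℝ) : ℂ) * Complex.I) =
      Complex.exp (((⟪c, w⟫ : ℝ) : ℂ) * Complex.I) *
      ((ENNReal.ofReal (gaussianRatio ⟪δ, w⟫ (1 - ‖δ‖ ^ 2) g)).toReal •
        Complex.exp (s * g * Complex.I)) := by
      intro g
      rw [tiltDensity, mul_smul_comm, ← Complex.exp_add]
      congr 2
      push_cast
      ring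
    simp_rw [h2]
    rw [integral_const_mul, h1, ← Complex.exp_add, ← Complex.exp_add]
    congr 1
    rw [inner_add_left, real_inner_smul_left, Real.coe_toNNReal _ hv.le]
    push_cast
    ring
  simp_rw [inner_eq]
  rw [integral_const_mul, integral_cexp_stdGaussian, ← Complex.exp_add]
  congr 1
  rw [norm_add_sq_real, real_inner_smul_right, norm_smul, real_inner_comm, mul_pow,
    Real.norm_eq_abs, sq_abs]
  push_cast
  ring

end Tilting

/-! ### Law of one observation as an image of a tilt -/

section Observations

section Fourier

variable {E : Type*} [NormedAddCommGroup E] [InnerProductSpace ℝ E] [FiniteDimensional ℝ E]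
  [MeasurableSpace E] [BorelSpace E]

/-- The product ℝ × E carries no inner product, so uniqueness goes through the dual characteristic
function; every functional on it is given by a pair (s, t). -/
lemma ext_of_integral_cexp (μ ν : Measure (ℝ × E)) [IsFiniteMeasure μ] [IsFiniteMeasure ν]
    (h : ∀ (s : ℝ) (t : E),
      ∫ z, Complex.exp (((s * z.1 + ⟪t, z.2⟫ : ℝ) : ℂ) * Complex.I) ∂μ =
        ∫ z, Complex.exp (((s * z.1 + ⟪t, z.2⟫ : ℝ) : ℂ) * Complex.I) ∂ν) : μ = ν := by
  have : SecondCountableTopology E := inferInstance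
  refine Measure.ext_of_charFunDual ?_
  ext L
  rw [charFunDual_apply, charFunDual_apply]
  obtain ⟨s, t, hL⟩ : ∃ (s : ℝ) (t : E), ∀ z, L z = s * z.1 + ⟪t, z.2⟫ := by
    refine ⟨L (1, 0), (InnerProductSpace.toDual ℝ E).symm
      (L.comp (ContinuousLinearMap.inr ℝ ℝ E)), fun z => ?_⟩
    rw [InnerProductSpace.toDual_symm_apply, ContinuousLinearMap.comp_apply,
      ContinuousLinearMap.inr_apply]
    have : z = z.1 • ((1 : ℝ), (0 : E)) + (0, z.2) := by
      obtain ⟨a, b⟩ := z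
      rw [Prod.smul_mk, Prod.mk_add_mk, smul_zero, zero_add, add_zero, smul_eq_mul, mul_one]
    conv_lhs => rw [this]
    rw [map_add, map_smul, smul_eq_mul, mul_comm]
  simp_rw [hL]
  exact h s t

end Fourier

variable {p : ℕ}

lemma inner_coef (θ : Param p) (x : EuclideanSpace ℝ (Coord p)) :
    ⟪θ.coef, x⟫ = x (Sum.inl ()) * θ.beta + ∑ j, x (Sum.inr j) * θ.gamma j := by
  simp [Param.coef, PiLp.inner_apply]

instance (θ : Param p) : IsProbabilityMeasure (obsLaw θ) :=
  Measure.isProbabilityMeasure_map (by fun_prop)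

lemma integral_cexp_obsLaw (θ : Param p) (hS : θ.Sigma.PosSemidef) (s : ℝ)
    (t : EuclideanSpace ℝ (Coord p)) :
    ∫ z, Complex.exp (((s * z.1 + ⟪t, z.2⟫ : ℝ) : ℂ) * Complex.I) ∂(obsLaw θ) =
      Complex.exp (-((s ^ 2 * θ.sigma ^ 2 +
        (t + s • θ.coef).ofLp ⬝ᵥ θ.Sigma.mulVec (t + s • θ.coef).ofLp : ℝ) : ℂ) / 2) := by
  rw [obsLaw, integral_map (by fun_prop) (by fun_prop)]
  have e : ∀ u : EuclideanSpace ℝ (Coord p) × ℝ,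
      Complex.exp (((s * (u.1 (Sum.inl ()) * θ.beta + ∑ j, u.1 (Sum.inr j) * θ.gamma j + u.2)
        + ⟪t, u.1⟫ : ℝ) : ℂ) * Complex.I) =
      Complex.exp (((⟪u.1, t + s • θ.coef⟫ : ℝ) : ℂ) * Complex.I) *
        Complex.exp (s * u.2 * Complex.I) := by
    intro u
    rw [← inner_coef, ← Complex.exp_add, inner_add_right, real_inner_smul_right,
      real_inner_comm t, real_inner_comm θ.coef]
    congr 1
    push_cast
    ring
  simp_rw [e]
  rw [integral_prod_mul (fun x => Complex.exp (((⟪x, t + s • θ.coef⟫ : ℝ) : ℂ) * Complex.I))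
    (fun g : ℝ => Complex.exp (s * g * Complex.I)), ← charFun_apply, ← charFun_apply_real,
    charFun_multivariateGaussian hS, charFun_gaussianReal, ← Complex.exp_add,
    Real.coe_toNNReal _ (sq_nonneg _), inner_zero_right]
  congr 1
  push_cast
  ring

/-- Both laws are centred Gaussian, so equality reduces to the identity `hquad` of quadratic forms.
-/
lemma obsLaw_eq_map_tiltLaw (θ : Param p) (hS : θ.Sigma.PosSemidef)
    {δ : EuclideanSpace ℝ (Coord p)} (hδ : ‖δ‖ ^ 2 < 1)
    {Φ : EuclideanSpace ℝ (Coord p) × ℝ → Obs p} (hΦ : Measurable Φ)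
    (k : ℝ → EuclideanSpace ℝ (Coord p) → ℝ)
    (c : ℝ → EuclideanSpace ℝ (Coord p) → EuclideanSpace ℝ (Coord p))
    (hlin : ∀ s t u, s * (Φ u).1 + ⟪t, (Φ u).2⟫ = ⟪c s t, u.1⟫ + k s t * u.2)
    (hquad : ∀ s t, k s t ^ 2 + ‖c s t‖ ^ 2 + 2 * k s t * ⟪δ, c s t⟫ = s ^ 2 * θ.sigma ^ 2 +
        (t + s • θ.coef).ofLp ⬝ᵥ θ.Sigma.mulVec (t + s • θ.coef).ofLp) :
    obsLaw θ = (tiltLaw δ).map Φ := by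
  have := isProbabilityMeasure_tiltLaw hδ
  refine ext_of_integral_cexp _ _ fun s t => ?_
  rw [integral_cexp_obsLaw θ hS, integral_map hΦ.aemeasurable (by fun_prop)]
  simp_rw [hlin]
  rw [integral_cexp_tiltLaw hδ, hquad]

lemma power_eq_integral_pi {n : ℕ} {θ : Param p} {Ω : Type*} [MeasurableSpace Ω] {μ : Measure Ω}
    [IsProbabilityMeasure μ] {Φ : Ω → Obs p} (hΦ : Measurable Φ) (hθ : obsLaw θ = μ.map Φ)
    {ψ : (Fin n → Obs p) → ℝ} (hψ : Measurable ψ) :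
    power ψ θ = ∫ D, ψ (fun i => Φ (D i)) ∂(Measure.pi fun _ : Fin n => μ) := by
  have := Measure.isProbabilityMeasure_map (μ := μ) hΦ.aemeasurable
  have hm : Measurable (fun (D : Fin n → Ω) i => Φ (D i)) :=
    measurable_pi_lambda _ fun i => hΦ.comp (measurable_pi_apply i)
  rw [power, dataLaw, hθ, ← Measure.pi_map_pi fun _ => hΦ.aemeasurable,
    integral_map hm.aemeasurable hψ.aestronglyMeasurable]

/-- Comparison of the power of a test at a reference parameter with its average power over
finitely many parameters obtained from the reference by tilting. -/
theorem abs_average_power_sub_le {J : Type*} [Fintype J] [Nonempty J] {n : ℕ} {θ₀ : Param p}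
    {θ : J → Param p} {δ : J → EuclideanSpace ℝ (Coord p)} {r : ℝ} (hr : r < 1)
    (hδ : ∀ j, ‖δ j‖ ^ 2 = r) {Φ : EuclideanSpace ℝ (Coord p) × ℝ → Obs p} (hΦ : Measurable Φ)
    (h₀ : obsLaw θ₀ = (tiltLaw (0 : EuclideanSpace ℝ (Coord p))).map Φ)
    (h : ∀ j, obsLaw (θ j) = (tiltLaw (δ j)).map Φ)
    {ψ : (Fin n → Obs p) → ℝ} (hψ : Measurable ψ) (hψ01 : ∀ D, 0 ≤ ψ D ∧ ψ D ≤ 1) :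
    |(∑ j, power ψ (θ j)) / Fintype.card J - power ψ θ₀| ≤
      √((∑ j, ∑ k, (1 / (1 - ⟪δ j, δ k⟫)) ^ n) / (Fintype.card J : ℝ) ^ 2 - 1) := by
  have hδ1 : ∀ j, ‖δ j‖ ^ 2 < 1 := fun j => (hδ j).trans_lt hr
  rw [tiltLaw_zero] at h₀
  have := fun j => isProbabilityMeasure_tiltLaw (hδ1 j)
  rw [power_eq_integral_pi hΦ h₀ hψ]
  simp_rw [fun j => power_eq_integral_pi hΦ (h j) hψ]
  exact abs_average_integral_pi_sub_le (refLaw (EuclideanSpace ℝ (Coord p))) n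
    (f := fun j => tiltDensity (δ j)) (fun j => tiltDensity_nonneg _)
    (fun j => integral_tiltDensity (hδ1 j)) (fun j => memLp_two_tiltDensity (hδ1 j))
    (fun j k => (integral_tiltDensity_mul hr (hδ j) (hδ k)).le)
    (φ := fun D => ψ (fun i => Φ (D i))) (by fun_prop) (fun _ => hψ01 _)

end Observations

/-! ### Eigenvalue bounds as bounds on quadratic forms -/

section Eigenvalues

variable {ι : Type*} [Fintype ι] [DecidableEq ι]

lemma EigenvaluesBetween.quadratic {a b : ℝ} {S : Matrix ι ι ℝ} (h : EigenvaluesBetween a b S)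
    (x : ι → ℝ) : a * ∑ i, x i ^ 2 ≤ x ⬝ᵥ S.mulVec x ∧ x ⬝ᵥ S.mulVec x ≤ b * ∑ i, x i ^ 2 := by
  obtain ⟨hS, hab⟩ := h
  set v := hS.eigenvectorBasis
  set y : EuclideanSpace ℝ ι := WithLp.toLp 2 x
  have hSt : S.transpose = S := by
    have := hS.eq
    rwa [Matrix.conjTranspose_eq_transpose_of_trivial] at this
  have h1 : x ⬝ᵥ S.mulVec x = ∑ i, hS.eigenvalues i * ⟪v i, y⟫ ^ 2 := by
    have := v.sum_inner_mul_inner y (WithLp.toLp 2 (S.mulVec x))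
    have e1 : ⟪y, WithLp.toLp 2 (S.mulVec x)⟫ = x ⬝ᵥ S.mulVec x := by
      simp [y, EuclideanSpace.inner_eq_star_dotProduct, dotProduct_comm]
    rw [← e1, ← this]
    refine Finset.sum_congr rfl fun i _ => ?_
    have e2 : ⟪v i, WithLp.toLp 2 (S.mulVec x)⟫ = hS.eigenvalues i * ⟪v i, y⟫ := by
      have e3 := hS.mulVec_eigenvectorBasis i
      simp only [EuclideanSpace.inner_eq_star_dotProduct, star_trivial, y]
      rw [dotProduct_comm, Matrix.dotProduct_mulVec, ← Matrix.mulVec_transpose, hSt, e3,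
        smul_dotProduct, smul_eq_mul, dotProduct_comm x]
    rw [e2, real_inner_comm]
    ring
  have h2 : ∑ i, x i ^ 2 = ∑ i, ⟪v i, y⟫ ^ 2 := by
    rw [v.sum_sq_inner_right, EuclideanSpace.real_norm_sq_eq]
  rw [h1, h2, Finset.mul_sum, Finset.mul_sum]
  constructor
  · gcongr with i _; exact (hab i).1
  · gcongr with i _; exact (hab i).2

lemma eigenvaluesBetween_of_quadratic {a b : ℝ} {S : Matrix ι ι ℝ} (hS : S.IsHermitian)
    (h : ∀ x : ι → ℝ, a * ∑ i, x i ^ 2 ≤ x ⬝ᵥ S.mulVec x ∧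
      x ⬝ᵥ S.mulVec x ≤ b * ∑ i, x i ^ 2) : EigenvaluesBetween a b S := by
  refine ⟨hS, fun i => ?_⟩
  have h1 := hS.eigenvalues_eq i
  have h2 : ∑ j, (hS.eigenvectorBasis i).ofLp j ^ 2 = 1 := by
    rw [← EuclideanSpace.real_norm_sq_eq, hS.eigenvectorBasis.norm_eq_one, one_pow]
  have h3 := h (hS.eigenvectorBasis i).ofLp
  rw [h2, mul_one, mul_one] at h3
  simp only [star_trivial, RCLike.re_to_real] at h1
  rwa [h1]

lemma EigenvaluesBetween.posDef {a b : ℝ} (ha : 0 < a) {S : Matrix ι ι ℝ}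
    (h : EigenvaluesBetween a b S) : S.PosDef :=
  h.1.posDef_iff_eigenvalues_pos.mpr fun i => ha.trans_le (h.2 i).1

end Eigenvalues

/-! ### Covariance matrices with standardized W -/

section Bordered

variable {p : ℕ}

/-- The covariance matrix of `(Z, W)` when `W` is standardized, `Z` has variance `τ` and
`π` is the vector of covariances of `Z` and `W`. -/
def bordered (τ : ℝ) (π : Fin (p - 1) → ℝ) : Matrix (Coord p) (Coord p) ℝ :=
  Matrix.fromBlocks (Matrix.of fun _ _ => τ) (Matrix.of fun _ j => π j)
    (Matrix.of fun i _ => π i) 1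

lemma eq_bordered {S : Matrix (Coord p) (Coord p) ℝ} (hS : S.IsHermitian)
    (h : S.toBlocks₂₂ = 1) :
    S = bordered (S (Sum.inl ()) (Sum.inl ())) (fun j => S (Sum.inl ()) (Sum.inr j)) := by
  conv_lhs => rw [← Matrix.fromBlocks_toBlocks S, h]
  rw [bordered]
  congr 1
  ext i j
  exact hS.apply (Sum.inl ()) (Sum.inr i)

lemma isHermitian_bordered (τ : ℝ) (π : Fin (p - 1) → ℝ) : (bordered τ π).IsHermitian := by
  refine Matrix.IsHermitian.ext fun i j => ?_
  rcases i with i | i <;> rcases j with j | j <;> simp [bordered, Matrix.one_apply, eq_comm]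

lemma toBlocks₂₂_bordered (τ : ℝ) (π : Fin (p - 1) → ℝ) : (bordered τ π).toBlocks₂₂ = 1 := by
  rw [bordered, Matrix.toBlocks_fromBlocks₂₂]

lemma dotProduct_bordered_mulVec (τ : ℝ) (π : Fin (p - 1) → ℝ) (x : Coord p → ℝ) :
    x ⬝ᵥ (bordered τ π).mulVec x = τ * x (Sum.inl ()) ^ 2 +
      2 * x (Sum.inl ()) * ∑ j, π j * x (Sum.inr j) + ∑ j, x (Sum.inr j) ^ 2 := by
  have h1 : (bordered τ π).mulVec x (Sum.inl ()) =
      τ * x (Sum.inl ()) + ∑ j, π j * x (Sum.inr j) := by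
    simp [bordered, Matrix.mulVec, dotProduct]
  have h2 : ∀ j, (bordered τ π).mulVec x (Sum.inr j) = π j * x (Sum.inl ()) + x (Sum.inr j) := by
    intro j
    simp [bordered, Matrix.mulVec, dotProduct, Matrix.one_apply]
  rw [dotProduct, Fintype.sum_sum_type]
  simp only [h1, h2, Finset.univ_unique, PUnit.default_eq_unit, Finset.sum_singleton]
  have : ∑ j, x (Sum.inr j) * (π j * x (Sum.inl ()) + x (Sum.inr j)) =
      x (Sum.inl ()) * ∑ j, π j * x (Sum.inr j) + ∑ j, x (Sum.inr j) ^ 2 := by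
    rw [Finset.mul_sum, ← Finset.sum_add_distrib]
    exact Finset.sum_congr rfl fun j _ => by ring
  rw [this]
  ring

lemma sum_coord_sq (x : Coord p → ℝ) :
    ∑ i, x i ^ 2 = x (Sum.inl ()) ^ 2 + ∑ j, x (Sum.inr j) ^ 2 := by
  simp [Fintype.sum_sum_type]

lemma EigenvaluesBetween.bordered_le {a b τ : ℝ} {π : Fin (p - 1) → ℝ}
    (h : EigenvaluesBetween a b (bordered τ π)) : τ ≤ b := by
  have := (h.quadratic (Sum.elim (fun _ => 1) 0)).2
  rw [dotProduct_bordered_mulVec, sum_coord_sq] at this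
  simpa using this

/-- Evaluate the form at (1, -π). This keeps the residual variance of Z given W away from zero. -/
lemma EigenvaluesBetween.le_schur {a b τ : ℝ} {π : Fin (p - 1) → ℝ} (ha : 0 ≤ a)
    (h : EigenvaluesBetween a b (bordered τ π)) : a ≤ τ - ∑ j, π j ^ 2 := by
  have := (h.quadratic (Sum.elim (fun _ => 1) (fun j => -π j))).1
  rw [dotProduct_bordered_mulVec, sum_coord_sq] at this
  simp only [Sum.elim_inl, Sum.elim_inr, one_pow, mul_one, mul_neg, Finset.sum_neg_distrib,
    neg_sq] at this
  have e : ∑ j, π j * π j = ∑ j, π j ^ 2 := Finset.sum_congr rfl fun _ _ => (sq _).symm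
  rw [e] at this
  have : 0 ≤ a * ∑ j, π j ^ 2 := mul_nonneg ha (Finset.sum_nonneg fun j _ => sq_nonneg _)
  linarith

/-- With Q = ‖π‖², the test vector (Q, π) and τ ≥ Q give Q(Q + 1)² ≤ bQ(Q + 1); the case Q = 0 needs
1 ≤ b. This bounds the length of (-1, π), the direction in which the coefficients move between
alternative and null. -/
lemma EigenvaluesBetween.one_add_sum_sq_le {a b τ : ℝ} {π : Fin (p - 1) → ℝ} (ha : 0 ≤ a)
    (hb : 1 ≤ b) (h : EigenvaluesBetween a b (bordered τ π)) : 1 + ∑ j, π j ^ 2 ≤ b := by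
  have hτ := h.le_schur ha
  set Q := ∑ j, π j ^ 2 with hQ
  have hQ0 : 0 ≤ Q := Finset.sum_nonneg fun j _ => sq_nonneg _
  have := (h.quadratic (Sum.elim (fun _ => Q) π)).2
  rw [dotProduct_bordered_mulVec, sum_coord_sq] at this
  simp only [Sum.elim_inl, Sum.elim_inr] at this
  have e : ∑ j, π j * π j = ∑ j, π j ^ 2 := Finset.sum_congr rfl fun _ _ => (sq _).symm
  rw [e, ← hQ] at this
  rcases hQ0.eq_or_lt with h0 | h0
  · linarith
  · have h1 : Q * Q ^ 2 ≤ τ * Q ^ 2 := by gcongr; linarith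
    have h2 : (Q * (Q + 1)) * (1 + Q) ≤ (Q * (Q + 1)) * b := by nlinarith
    exact le_of_mul_le_mul_left h2 (by positivity)

/-- The perturbation of the border has operator norm at most ε: Cauchy–Schwarz, then 4x₀²w ≤ (x₀² +
w)². -/
lemma EigenvaluesBetween.bordered_add {a b a' b' τ ε : ℝ} {π ξ : Fin (p - 1) → ℝ}
    (h : EigenvaluesBetween a b (bordered τ π)) (hε : 0 ≤ ε) (hξ : ∑ j, ξ j ^ 2 ≤ ε ^ 2)
    (ha : a' ≤ a - ε) (hb : b + ε ≤ b') : EigenvaluesBetween a' b' (bordered τ (π + ξ)) := by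
  refine eigenvaluesBetween_of_quadratic (isHermitian_bordered _ _) fun x => ?_
  have h1 := h.quadratic x
  rw [dotProduct_bordered_mulVec] at h1 ⊢
  have e : ∑ j, (π + ξ) j * x (Sum.inr j) =
      ∑ j, π j * x (Sum.inr j) + ∑ j, ξ j * x (Sum.inr j) := by
    rw [← Finset.sum_add_distrib]
    exact Finset.sum_congr rfl fun j _ => by rw [Pi.add_apply]; ring
  rw [e]
  have hN := sum_coord_sq x
  set N := ∑ i, x i ^ 2
  set x₀ := x (Sum.inl ())
  set w := ∑ j, x (Sum.inr j) ^ 2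
  set y := ∑ j, ξ j * x (Sum.inr j)
  have hw : 0 ≤ w := Finset.sum_nonneg fun j _ => sq_nonneg _
  have hN0 : 0 ≤ N := by rw [hN]; positivity
  have hy : y ^ 2 ≤ ε ^ 2 * w := (Finset.sum_mul_sq_le_sq_mul_sq _ _ _).trans (by gcongr)
  have hcross : |2 * x₀ * y| ≤ ε * N := by
    refine abs_le_of_sq_le_sq ?_ (by positivity)
    have : (ε * (x₀ ^ 2 + w)) ^ 2 - 4 * x₀ ^ 2 * (ε ^ 2 * w) = (ε * (x₀ ^ 2 - w)) ^ 2 := by ring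
    have h4 : 4 * x₀ ^ 2 * y ^ 2 ≤ 4 * x₀ ^ 2 * (ε ^ 2 * w) := by gcongr
    rw [hN]
    nlinarith [sq_nonneg (ε * (x₀ ^ 2 - w))]
  obtain ⟨h5, h6⟩ := abs_le.mp hcross
  have h7 : a' * N ≤ (a - ε) * N := by gcongr
  have h8 : (b + ε) * N ≤ b' * N := by gcongr
  constructor <;> nlinarith

/-- The first row of Ω Σ = 1 reads Ω₀ⱼ = -Ω₀₀ πⱼ with Ω₀₀ ≠ 0, so row sparsity counts the support of
π plus the diagonal entry. -/
lemma rowSparsity_bordered {θ : Param p} {τ : ℝ} {π : Fin (p - 1) → ℝ}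
    (hθ : θ.Sigma = bordered τ π) (hdet : IsUnit θ.Sigma.det) :
    θ.rowSparsity = 1 + (Finset.univ.filter fun j => π j ≠ 0).card := by
  have hinv := Matrix.nonsing_inv_mul _ hdet
  set Ω := θ.Sigma⁻¹
  have hrow : ∀ j, Ω (Sum.inl ()) (Sum.inl ()) * π j + Ω (Sum.inl ()) (Sum.inr j) = 0 := by
    intro j
    have := congrFun (congrFun hinv (Sum.inl ())) (Sum.inr j)
    rw [hθ, Matrix.mul_apply, Fintype.sum_sum_type] at this
    simpa [bordered, Matrix.one_apply] using this
  have h0 : Ω (Sum.inl ()) (Sum.inl ()) ≠ 0 := by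
    intro h
    have hz : ∀ j, Ω (Sum.inl ()) j = 0 := by
      rintro (⟨⟩ | j)
      · exact h
      · simpa [h] using hrow j
    have := congrFun (congrFun hinv (Sum.inl ())) (Sum.inl ())
    rw [Matrix.mul_apply] at this
    simp [hz] at this
  have hset : {j : Coord p | Ω (Sum.inl ()) j ≠ 0} =
      ((Finset.univ : Finset Unit).disjSum (Finset.univ.filter fun j => π j ≠ 0) :
        Finset (Coord p)) := by
    ext j
    rcases j with ⟨⟩ | j
    · simp [h0]
    · have : Ω (Sum.inl ()) (Sum.inr j) = -(Ω (Sum.inl ()) (Sum.inl ()) * π j) := by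
        linarith [hrow j]
      simp [this, h0]
  rw [Param.rowSparsity, hset, Set.ncard_coe_finset, Finset.card_disjSum]
  simp

end Bordered

/-! ### Alternatives and null parameters under a common linear map -/

section LinearImages

variable {p : ℕ}

/-- The vector with coordinates `d` and `η`. -/
def joinVec (d : ℝ) (η : Fin (p - 1) → ℝ) : EuclideanSpace ℝ (Coord p) :=
  WithLp.toLp 2 (Sum.elim (fun _ => d) η)

lemma inner_joinVec (d : ℝ) (η : Fin (p - 1) → ℝ) (x : EuclideanSpace ℝ (Coord p)) :
    ⟪joinVec d η, x⟫ = d * x (Sum.inl ()) + η ⬝ᵥ fun j => x (Sum.inr j) := by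
  simp [joinVec, PiLp.inner_apply, dotProduct, mul_comm]

lemma inner_joinVec_joinVec (d e : ℝ) (η ξ : Fin (p - 1) → ℝ) :
    ⟪joinVec d η, joinVec e ξ⟫ = d * e + η ⬝ᵥ ξ := by
  rw [inner_joinVec]
  simp [joinVec]

lemma norm_joinVec_sq (d : ℝ) (η : Fin (p - 1) → ℝ) :
    ‖joinVec d η‖ ^ 2 = d ^ 2 + η ⬝ᵥ η := by
  rw [← real_inner_self_eq_norm_sq, inner_joinVec_joinVec, sq]

/-- The observation whose design vector has `Z = ⟨π, W⟩ + v₁ g + v₂ w` and whose response is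
`β₀ Z + ⟨μ, W⟩ + e₁ g + e₂ w`, where `w` and `W` are the two parts of the first argument and `g` is
the second one. -/
def linearObs (β₀ v₁ v₂ e₁ e₂ : ℝ) (π μ : Fin (p - 1) → ℝ)
    (u : EuclideanSpace ℝ (Coord p) × ℝ) : Obs p :=
  (β₀ * (v₁ * u.2 + v₂ * u.1 (Sum.inl ()) + ∑ j, π j * u.1 (Sum.inr j)) +
      ∑ j, μ j * u.1 (Sum.inr j) + e₁ * u.2 + e₂ * u.1 (Sum.inl ()),
    joinVec (v₁ * u.2 + v₂ * u.1 (Sum.inl ()) + ∑ j, π j * u.1 (Sum.inr j))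
      (fun j => u.1 (Sum.inr j)))

@[fun_prop]
lemma measurable_linearObs (β₀ v₁ v₂ e₁ e₂ : ℝ) (π μ : Fin (p - 1) → ℝ) :
    Measurable (linearObs β₀ v₁ v₂ e₁ e₂ π μ) := by
  unfold linearObs joinVec
  refine Measurable.prodMk (by fun_prop) ?_
  refine (WithLp.measurable_toLp 2 _).comp (measurable_pi_lambda _ fun i => ?_)
  rcases i with i | i <;> simp only [Sum.elim_inl, Sum.elim_inr] <;> fun_prop

/-- With T = sβ₀ + t_Z and y = t_W + sμ, the quantities β₀ and μ enter only through θ.beta - β₀ and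
θ.gamma - μ. -/
lemma obsLaw_eq_map_linearObs {β₀ v₁ v₂ e₁ e₂ τ d : ℝ} {π μ π' η : Fin (p - 1) → ℝ}
    (θ : Param p) (hS : θ.Sigma.PosSemidef) (hSig : θ.Sigma = bordered τ π')
    (hδ : ‖joinVec d η‖ ^ 2 < 1)
    (hquad : ∀ (s T : ℝ) (y : Fin (p - 1) → ℝ),
      (T * v₁ + s * e₁) ^ 2 + (T * v₂ + s * e₂) ^ 2 + (T • π + y) ⬝ᵥ (T • π + y) +
        2 * (T * v₁ + s * e₁) * (d * (T * v₂ + s * e₂) + η ⬝ᵥ (T • π + y)) =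
      s ^ 2 * θ.sigma ^ 2 + τ * (T + s * (θ.beta - β₀)) ^ 2 +
        2 * (T + s * (θ.beta - β₀)) * (π' ⬝ᵥ (y + s • (θ.gamma - μ))) +
        (y + s • (θ.gamma - μ)) ⬝ᵥ (y + s • (θ.gamma - μ))) :
    obsLaw θ = (tiltLaw (joinVec d η)).map (linearObs β₀ v₁ v₂ e₁ e₂ π μ) := by
  refine obsLaw_eq_map_tiltLaw θ hS hδ (measurable_linearObs _ _ _ _ _ _ _)
    (fun s t => (s * β₀ + t (Sum.inl ())) * v₁ + s * e₁)
    (fun s t => joinVec ((s * β₀ + t (Sum.inl ())) * v₂ + s * e₂)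
      ((s * β₀ + t (Sum.inl ())) • π + ((fun j => t (Sum.inr j)) + s • μ))) ?_ ?_
  · intro s t u
    rw [linearObs, real_inner_comm, inner_joinVec, inner_joinVec]
    simp only [add_dotProduct, smul_dotProduct, smul_eq_mul]
    rw [dotProduct_comm (fun j => u.1 (Sum.inr j))]
    simp only [dotProduct]
    ring
  · intro s t
    rw [norm_joinVec_sq, inner_joinVec_joinVec, hSig, dotProduct_bordered_mulVec]
    have h := hquad s (s * β₀ + t (Sum.inl ())) ((fun j => t (Sum.inr j)) + s • μ)
    have e1 : (fun j => t (Sum.inr j)) + s • μ + s • (θ.gamma - μ) =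
        fun j => (t + s • θ.coef) (Sum.inr j) := by
      ext j; simp [Param.coef]; ring
    have e2 : s * β₀ + t (Sum.inl ()) + s * (θ.beta - β₀) = (t + s • θ.coef) (Sum.inl ()) := by
      simp [Param.coef]; ring
    rw [e1, e2] at h
    have e3 : ∀ f : Fin (p - 1) → ℝ, f ⬝ᵥ f = ∑ j, f j ^ 2 := fun f =>
      Finset.sum_congr rfl fun _ _ => (sq _).symm
    rw [e3 (fun j => (t + s • θ.coef) (Sum.inr j))] at h
    simp only [dotProduct] at h ⊢
    linarith

/-- The model `θ` is a linear image of independent standard Gaussian variables. -/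
lemma obsLaw_eq_map_of_untilted {β₀ a v₁ v₂ e₁ e₂ τ σ : ℝ} {π γ : Fin (p - 1) → ℝ}
    (hS : (bordered τ π).PosSemidef) (hv : v₁ ^ 2 + v₂ ^ 2 = τ - π ⬝ᵥ π)
    (hve : v₁ * e₁ + v₂ * e₂ = a * (τ - π ⬝ᵥ π))
    (he : e₁ ^ 2 + e₂ ^ 2 = a ^ 2 * (τ - π ⬝ᵥ π) + σ ^ 2) :
    obsLaw (⟨β₀ + a, γ, bordered τ π, σ⟩ : Param p) =
      (tiltLaw (0 : EuclideanSpace ℝ (Coord p))).map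
        (linearObs β₀ v₁ v₂ e₁ e₂ π (γ + a • π)) := by
  have h0 : (0 : EuclideanSpace ℝ (Coord p)) = joinVec 0 0 := by
    ext j; rcases j with j | j <;> simp [joinVec]
  rw [h0]
  refine obsLaw_eq_map_linearObs _ hS rfl (by rw [norm_joinVec_sq]; simp) fun s T y => ?_
  simp only [add_dotProduct, dotProduct_add, smul_dotProduct, dotProduct_smul, smul_eq_mul,
    dotProduct_sub, sub_dotProduct, zero_dotProduct, dotProduct_comm y π, dotProduct_comm y γ,
    dotProduct_comm γ π]
  linear_combination T ^ 2 * hv + 2 * T * s * hve + s ^ 2 * he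

/-- The excess covariance with W is ξ for the residuals of both Z and y - β₀Z. Hence both load on g
with the same coefficient k, and covariance qξ of g with W, where qk = 1, produces it. -/
lemma obsLaw_eq_map_of_tilted_covariates {β₀ a k v₂ e₂ τ σ σ' q : ℝ} {π γ ξ : Fin (p - 1) → ℝ}
    (hS : (bordered τ (π + ξ)).PosSemidef) (hδ : ‖joinVec 0 (q • ξ)‖ ^ 2 < 1)
    (hv : k ^ 2 + v₂ ^ 2 = τ - π ⬝ᵥ π) (hve : k * k + v₂ * e₂ = a * (τ - π ⬝ᵥ π))
    (he : k ^ 2 + e₂ ^ 2 = a ^ 2 * (τ - π ⬝ᵥ π) + σ ^ 2) (hq : q * k = 1)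
    (hξ : ξ ⬝ᵥ ξ = a * (τ - π ⬝ᵥ π)) (hπξ : π ⬝ᵥ ξ = 0)
    (hσ' : σ' ^ 2 = σ ^ 2 - a * (1 - a) * (τ - π ⬝ᵥ π)) :
    obsLaw (⟨β₀, γ + a • π + ξ, bordered τ (π + ξ), σ'⟩ : Param p) =
      (tiltLaw (joinVec 0 (q • ξ))).map (linearObs β₀ k v₂ k e₂ π (γ + a • π)) := by
  refine obsLaw_eq_map_linearObs _ hS rfl hδ fun s T y => ?_
  rw [add_sub_cancel_left]
  simp only [add_dotProduct, dotProduct_add, smul_dotProduct, dotProduct_smul, smul_eq_mul,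
    dotProduct_comm y π, dotProduct_comm y ξ, dotProduct_comm ξ π, hπξ, hξ, hσ']
  linear_combination T ^ 2 * hv + 2 * T * s * hve + s ^ 2 * he
    + 2 * (T + s) * (ξ ⬝ᵥ y) * hq

/-- The term a · (residual of Z given W) + ε is read as noise σ'g; its correlation with the
normalized residual of Z is d. -/
lemma obsLaw_eq_map_of_tilted_noise {β₀ a τ σ σ' v d : ℝ} {π γ : Fin (p - 1) → ℝ}
    (hS : (bordered τ π).PosSemidef) (hδ : ‖joinVec (p := p) d 0‖ ^ 2 < 1)
    (hv : v ^ 2 = τ - π ⬝ᵥ π) (hσ' : σ' ^ 2 = σ ^ 2 + a ^ 2 * (τ - π ⬝ᵥ π))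
    (hd : σ' * d = a * v) :
    obsLaw (⟨β₀ + a, γ, bordered τ π, σ⟩ : Param p) =
      (tiltLaw (joinVec d 0)).map (linearObs β₀ 0 v σ' 0 π (γ + a • π)) := by
  refine obsLaw_eq_map_linearObs _ hS rfl hδ fun s T y => ?_
  simp only [add_dotProduct, dotProduct_add, smul_dotProduct, dotProduct_smul, smul_eq_mul,
    dotProduct_sub, sub_dotProduct, zero_dotProduct, dotProduct_comm y π, dotProduct_comm y γ,
    dotProduct_comm γ π]
  linear_combination s ^ 2 * hσ' + (T ^ 2 + 2 * s * T * a) * hv + 2 * s * T * v * hd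

end LinearImages

/-! ### Exponential moments of the overlap of two random choices -/

section Overlap

variable {m L : ℕ}

/-- The number of indices at which two functions agree. -/
def agreement (J K : Fin m → Fin L) : ℕ := (Finset.univ.filter fun i => J i = K i).card

/-- The sum factors over the m indices; among the L² pairs at each index, L agree and have weight
eˣ, the others weight 1. -/
lemma sum_sum_exp_agreement (x : ℝ) :
    ∑ J : Fin m → Fin L, ∑ K : Fin m → Fin L, Real.exp (x * agreement J K) =
      ((L : ℝ) ^ 2 + L * (Real.exp x - 1)) ^ m := by
  have h1 : ∀ J K : Fin m → Fin L, Real.exp (x * agreement J K) =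
      ∏ i, if J i = K i then Real.exp x else 1 := by
    intro J K
    rw [Finset.prod_ite, Finset.prod_const_one, mul_one, Finset.prod_const, ← Real.exp_nat_mul,
      agreement, mul_comm]
  have h2 : ∀ j : Fin L, ∑ k : Fin L, (if j = k then Real.exp x else 1) =
      L + (Real.exp x - 1) := by
    intro j
    have : ∀ k : Fin L, (if j = k then Real.exp x else 1) =
        1 + if j = k then Real.exp x - 1 else 0 := by
      intro k; split_ifs <;> ring
    simp_rw [this]
    rw [Finset.sum_add_distrib]
    simp
  simp_rw [h1]
  have h3 : ∀ J : Fin m → Fin L, ∑ K : Fin m → Fin L, ∏ i, (if J i = K i then Real.exp x else 1) =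
      (L + (Real.exp x - 1)) ^ m := by
    intro J
    rw [← Fintype.prod_sum fun i (k : Fin L) => if J i = k then Real.exp x else 1]
    simp_rw [h2]
    simp
  simp_rw [h3]
  rw [Finset.sum_const, Finset.card_univ, Fintype.card_fun, Fintype.card_fin, Fintype.card_fin,
    nsmul_eq_mul, Nat.cast_pow, ← mul_pow]
  congr 1
  ring

lemma average_exp_agreement_le (hL : 0 < L) (x : ℝ) :
    (∑ J : Fin m → Fin L, ∑ K : Fin m → Fin L, Real.exp (x * agreement J K)) /
      (Fintype.card (Fin m → Fin L) : ℝ) ^ 2 ≤ Real.exp (m * Real.exp x / L) := by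
  have hL' : (0 : ℝ) < L := by exact_mod_cast hL
  rw [sum_sum_exp_agreement, Fintype.card_fun, Fintype.card_fin, Fintype.card_fin, Nat.cast_pow,
    ← pow_mul, mul_comm m 2, pow_mul, ← div_pow, mul_div_assoc, Real.exp_nat_mul]
  have h0 : ((L : ℝ) ^ 2 + L * (Real.exp x - 1)) / L ^ 2 = 1 + (Real.exp x - 1) / L := by
    field_simp
  have h1 : 0 ≤ ((L : ℝ) ^ 2 + L * (Real.exp x - 1)) / L ^ 2 := by
    have : (1 : ℝ) ≤ L := by exact_mod_cast hL
    have := Real.exp_pos x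
    have : 0 ≤ (L : ℝ) * (L - 1) := mul_nonneg hL'.le (by linarith)
    have : (0 : ℝ) ≤ L ^ 2 + L * (Real.exp x - 1) := by nlinarith
    positivity
  refine pow_le_pow_left₀ h1 ?_ m
  rw [h0]
  have h2 : (Real.exp x - 1) / L ≤ Real.exp x / L := by gcongr; linarith
  linarith [Real.add_one_le_exp (Real.exp x / L)]

lemma inv_one_sub_pow_le_exp {x : ℝ} (hx0 : 0 ≤ x) (hx : x ≤ 1 / 2) (n : ℕ) :
    (1 / (1 - x)) ^ n ≤ Real.exp (2 * n * x) := by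
  have h1 : 1 / (1 - x) ≤ Real.exp (2 * x) := by
    rw [div_le_iff₀ (by linarith)]
    have := Real.add_one_le_exp (2 * x)
    nlinarith
  calc (1 / (1 - x)) ^ n ≤ Real.exp (2 * x) ^ n :=
        pow_le_pow_left₀ (one_div_nonneg.mpr (by linarith)) h1 n
    _ = _ := by rw [← Real.exp_nat_mul]; congr 1; ring

end Overlap

/-! ### Sparse block perturbations -/

section Perturbation

variable {m L : ℕ} {κ : Type*} [Fintype κ] [DecidableEq κ]

/-- The vector with entries `b` at the positions `e (i, J i)` and `0` elsewhere. -/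
def blockVec (e : Fin m × Fin L → κ) (b : ℝ) (J : Fin m → Fin L) : κ → ℝ :=
  ∑ i, Pi.single (e (i, J i)) b

lemma dotProduct_blockVec (e : Fin m × Fin L → κ) (b : ℝ) (J : Fin m → Fin L) (π : κ → ℝ) :
    π ⬝ᵥ blockVec e b J = ∑ i, π (e (i, J i)) * b := by
  rw [blockVec, dotProduct_sum]
  simp

omit [Fintype κ] in
lemma blockVec_apply {e : Fin m × Fin L → κ} (he : Function.Injective e) (b : ℝ)
    (J : Fin m → Fin L) (i : Fin m) (l : Fin L) :
    blockVec e b J (e (i, l)) = if J i = l then b else 0 := by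
  rw [blockVec, Finset.sum_apply, Finset.sum_eq_single i]
  · simp [Pi.single_apply, he.eq_iff, eq_comm]
  · intro k _ hk
    rw [Pi.single_apply, if_neg]
    intro h
    exact hk (Prod.ext_iff.mp (he h)).1.symm
  · simp

lemma blockVec_dotProduct_blockVec {e : Fin m × Fin L → κ} (he : Function.Injective e) (b : ℝ)
    (J K : Fin m → Fin L) : blockVec e b J ⬝ᵥ blockVec e b K = b ^ 2 * agreement J K := by
  rw [dotProduct_blockVec, ← Finset.sum_mul]
  simp_rw [blockVec_apply he]
  rw [← Finset.sum_filter, Finset.sum_const, agreement, nsmul_eq_mul]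
  ring

lemma agreement_self (J : Fin m → Fin L) : agreement J J = m := by simp [agreement]

lemma agreement_le (J K : Fin m → Fin L) : agreement J K ≤ m :=
  (Finset.card_filter_le _ _).trans (by simp)

lemma card_support_blockVec_le (e : Fin m × Fin L → κ) (b : ℝ) (J : Fin m → Fin L) :
    (Finset.univ.filter fun j => blockVec e b J j ≠ 0).card ≤ m := by
  refine (Finset.card_le_card (t := Finset.univ.image fun i => e (i, J i)) fun j hj => ?_).trans
    (Finset.card_image_le.trans (by simp))
  simp only [Finset.mem_filter, Finset.mem_univ, true_and, Finset.mem_image] at hj ⊢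
  by_contra! hne
  refine hj ?_
  rw [blockVec, Finset.sum_apply]
  exact Finset.sum_eq_zero fun i _ => by rw [Pi.single_apply, if_neg (hne i).symm]

end Perturbation

/-! ### Power at an alternative against power at null parameters -/

section PowerComparison

variable {p : ℕ}

lemma EigenvaluesBetween.mono {ι : Type*} [Fintype ι] [DecidableEq ι] {a b a' b' : ℝ}
    {S : Matrix ι ι ℝ} (h : EigenvaluesBetween a b S) (ha : a' ≤ a) (hb : b ≤ b') :
    EigenvaluesBetween a' b' S :=
  ⟨h.1, fun i => ⟨ha.trans (h.2 i).1, (h.2 i).2.trans hb⟩⟩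

/-- The number of nonzero coordinates. -/
def supportSize (π : Fin (p - 1) → ℝ) : ℕ := (Finset.univ.filter fun j => π j ≠ 0).card

lemma supportSize_add_le (π ξ : Fin (p - 1) → ℝ) :
    supportSize (π + ξ) ≤ supportSize π + supportSize ξ := by
  refine (Finset.card_le_card fun j hj => ?_).trans (Finset.card_union_le _ _)
  simp only [Finset.mem_filter, Finset.mem_univ, true_and, Finset.mem_union, Pi.add_apply] at hj ⊢
  by_contra! h
  exact hj (by rw [h.1, h.2, add_zero])

lemma exists_eq_of_mem_altSpace {M M₁ M₂ ζ κ s₀ β₀ h : ℝ} (hM : 1 < M) {θ : Param p}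
    (hθ : θ ∈ altSpace p M M₁ M₂ ζ κ s₀ β₀ h) :
    ∃ (a τ σ : ℝ) (γ π : Fin (p - 1) → ℝ), θ = ⟨β₀ + a, γ, bordered τ π, σ⟩ ∧ 0 ≤ a ∧ a ≤ h ∧
      EigenvaluesBetween (ζ * M)⁻¹ (ζ * M) (bordered τ π) ∧ κ ≤ σ ∧ σ ≤ ζ * M₁ ∧
      ‖θ.coef‖ ≤ ζ * M₂ ∧ ((1 + supportSize π : ℕ) : ℝ) ≤ s₀ := by
  obtain ⟨⟨a, ha0, hah, ⟨⟨hE, hB, -, -, -⟩, hb, hs⟩⟩, hc, hE', hκ, hσ⟩ := hθ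
  have hS := eq_bordered hE.1 hB
  refine ⟨a, _, θ.sigma, θ.gamma, _, ?_, ha0, hah, hS ▸ hE', hκ, hσ, hc, ?_⟩
  · obtain ⟨b, g, S, σ⟩ := θ
    simp only [Param.mk.injEq, true_and, and_true]
    exact ⟨hb, hS⟩
  · rw [rowSparsity_bordered hS
      (hE.posDef (inv_pos.mpr (by linarith))).det_pos.ne'.isUnit] at hs
    exact hs

lemma coef_eq (β₀ a τ τ' σ σ' : ℝ) (γ π π' ξ : Fin (p - 1) → ℝ) :
    (⟨β₀, γ + a • π + ξ, bordered τ' π', σ'⟩ : Param p).coef =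
      (⟨β₀ + a, γ, bordered τ π, σ⟩ : Param p).coef + a • joinVec (-1) π + joinVec 0 ξ := by
  ext j
  rcases j with j | j <;> simp [Param.coef, joinVec]

lemma dotProduct_self_eq_sum_sq (f : Fin (p - 1) → ℝ) : f ⬝ᵥ f = ∑ j, f j ^ 2 :=
  Finset.sum_congr rfl fun _ _ => (sq _).symm

lemma norm_coef_le {A B a ε M₂ : ℝ} (β₀ τ τ' σ σ' : ℝ) (γ π π' ξ : Fin (p - 1) → ℝ)
    (hA : 0 ≤ A) (hB : 1 ≤ B) (ha : 0 ≤ a) (hε : 0 ≤ ε)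
    (hE : EigenvaluesBetween A B (bordered τ π)) (hξ : ξ ⬝ᵥ ξ ≤ ε ^ 2)
    (hc : ‖(⟨β₀ + a, γ, bordered τ π, σ⟩ : Param p).coef‖ + a * √B + ε ≤ M₂) :
    ‖(⟨β₀, γ + a • π + ξ, bordered τ' π', σ'⟩ : Param p).coef‖ ≤ M₂ := by
  rw [coef_eq β₀ a τ τ' σ σ']
  have h1 : ‖joinVec (-1) π‖ ≤ √B := by
    refine Real.le_sqrt_of_sq_le ?_
    rw [norm_joinVec_sq, dotProduct_self_eq_sum_sq]
    have := hE.one_add_sum_sq_le hA hB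
    linarith
  have h2 : ‖joinVec 0 ξ‖ ≤ ε := by
    refine abs_le_of_sq_le_sq' ?_ hε |>.2
    rw [norm_joinVec_sq]
    simpa using hξ
  have h3 : ‖a • joinVec (-1) π‖ ≤ a * √B := by
    rw [norm_smul, Real.norm_of_nonneg ha]
    gcongr
  have h4 := norm_add₃_le (a := (⟨β₀ + a, γ, bordered τ π, σ⟩ : Param p).coef)
    (b := a • joinVec (-1) π) (c := joinVec 0 ξ)
  linarith

lemma mem_nullSpace_of_bordered {M M₁ M₂ s₀ β₀ τ σ : ℝ} {γ π : Fin (p - 1) → ℝ} (hM : 0 < M)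
    (hE : EigenvaluesBetween M⁻¹ M (bordered τ π)) (hσ : 0 ≤ σ) (hσ' : σ ≤ M₁)
    (hc : ‖(⟨β₀, γ, bordered τ π, σ⟩ : Param p).coef‖ ≤ M₂)
    (hs : ((1 + supportSize π : ℕ) : ℝ) ≤ s₀) :
    (⟨β₀, γ, bordered τ π, σ⟩ : Param p) ∈ nullSpace p M M₁ M₂ s₀ β₀ := by
  refine ⟨⟨hE, toBlocks₂₂_bordered _ _, hσ, hσ', hc⟩, rfl, ?_⟩
  rw [rowSparsity_bordered rfl (hE.posDef (inv_pos.mpr hM)).det_pos.ne'.isUnit]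
  exact hs

/-- A test of the null hypothesis has small power at an alternative that differs little from a null
parameter with the same design and larger noise. -/
theorem power_le_of_tilted_noise {M M₁ M₂ s₀ β₀ α A B a τ σ : ℝ} {γ π : Fin (p - 1) → ℝ} {n : ℕ}
    {ψ : (Fin n → Obs p) → ℝ} (hM : 0 < M) (hA : M⁻¹ ≤ A) (hB1 : 1 ≤ B) (hB : B ≤ M)
    (hE : EigenvaluesBetween A B (bordered τ π)) (ha : 0 ≤ a) (hσ : 0 < σ)
    (hσM : σ ^ 2 + a ^ 2 * B ≤ M₁ ^ 2) (hM₁ : 0 ≤ M₁)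
    (hc : ‖(⟨β₀ + a, γ, bordered τ π, σ⟩ : Param p).coef‖ + a * √B ≤ M₂)
    (hs : ((1 + supportSize π : ℕ) : ℝ) ≤ s₀) (hsmall : a ^ 2 * B / σ ^ 2 ≤ 1 / 2)
    (hψ : ψ ∈ tests n α (nullSpace p M M₁ M₂ s₀ β₀)) :
    power ψ (⟨β₀ + a, γ, bordered τ π, σ⟩ : Param p) ≤
      α + √(Real.exp (2 * n * (a ^ 2 * B / σ ^ 2)) - 1) := by
  have hA0 : 0 < A := (inv_pos.mpr hM).trans_le hA
  have hpsd := (hE.posDef hA0).posSemidef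
  set v := τ - π ⬝ᵥ π with hv
  have hv0 : 0 < v := hA0.trans_le (by
    rw [hv, dotProduct_self_eq_sum_sq]; exact hE.le_schur hA0.le)
  have hvB : v ≤ B := by
    have h1 := hE.bordered_le
    have h2 : 0 ≤ π ⬝ᵥ π := by
      rw [dotProduct_self_eq_sum_sq]; exact Finset.sum_nonneg fun j _ => sq_nonneg _
    linarith
  set σ' := √(σ ^ 2 + a ^ 2 * v) with hσ'
  have hσ'2 : σ' ^ 2 = σ ^ 2 + a ^ 2 * v := Real.sq_sqrt (by positivity)
  have hσ'0 : 0 < σ' := Real.sqrt_pos.mpr (by positivity)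
  set d := a * √v / σ'
  have hd2 : d ^ 2 ≤ a ^ 2 * B / σ ^ 2 := by
    simp only [d]
    rw [div_pow, mul_pow, Real.sq_sqrt hv0.le, hσ'2]
    gcongr
    have : 0 ≤ a ^ 2 * v := by positivity
    linarith
  have hnorm : ‖joinVec (p := p) d 0‖ ^ 2 = d ^ 2 := by rw [norm_joinVec_sq]; simp
  -- Here the null parameter is the untilted reference and the alternative is the only tilt.
  have h₀ := obsLaw_eq_map_of_untilted (β₀ := β₀) (a := 0) (v₁ := 0) (v₂ := √v) (e₁ := σ')
    (e₂ := 0) (σ := σ') (γ := γ + a • π) hpsd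
    (by rw [Real.sq_sqrt hv0.le]; ring) (by ring) (by ring)
  rw [add_zero, zero_smul, add_zero] at h₀
  have h₁ := obsLaw_eq_map_of_tilted_noise (β₀ := β₀) (a := a) (v := √v) (d := d) (σ := σ)
    (σ' := σ') (γ := γ) hpsd (by rw [hnorm]; linarith) (Real.sq_sqrt hv0.le) hσ'2
    (by simp only [d]; field_simp)
  have key := abs_average_power_sub_le (J := Unit) (n := n) (r := d ^ 2) (by linarith)
    (fun _ => hnorm) (measurable_linearObs _ _ _ _ _ _ _) h₀ (fun _ => h₁) hψ.1 hψ.2.1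
  have hnull : (⟨β₀, γ + a • π, bordered τ π, σ'⟩ : Param p) ∈ nullSpace p M M₁ M₂ s₀ β₀ := by
    refine mem_nullSpace_of_bordered hM (hE.mono hA hB) hσ'0.le ?_ ?_ hs
    · refine abs_le_of_sq_le_sq' ?_ hM₁ |>.2
      rw [hσ'2]
      have : a ^ 2 * v ≤ a ^ 2 * B := by gcongr
      linarith
    · have := norm_coef_le (ε := 0) (ξ := 0) β₀ τ τ σ σ' γ π π hA0.le hB1 ha le_rfl hE (by simp)
        (by simpa using hc)
      simpa using this
  have hα := hψ.2.2 _ hnull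
  simp only [Finset.univ_unique, PUnit.default_eq_unit, Finset.sum_const, Finset.card_singleton,
    one_smul, Fintype.card_unit, Nat.cast_one, div_one, one_pow] at key
  rw [inner_joinVec_joinVec, zero_dotProduct, add_zero, ← sq] at key
  have h2 := inv_one_sub_pow_le_exp (sq_nonneg d) (hd2.trans hsmall) n
  have h3 : Real.exp (2 * n * d ^ 2) ≤ Real.exp (2 * n * (a ^ 2 * B / σ ^ 2)) := by gcongr
  have h4 : √((1 / (1 - d ^ 2)) ^ n - 1) ≤
      √(Real.exp (2 * n * (a ^ 2 * B / σ ^ 2)) - 1) := Real.sqrt_le_sqrt (by linarith)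
  linarith [(abs_le.mp key).2]

/-- A test of the null hypothesis has small power at an alternative, by comparison with a mixture
of null parameters whose covariances of `Z` and `W` are perturbed at one random coordinate in each
of `m` blocks of size `L`. -/
theorem power_le_of_tilted_covariates {M M₁ M₂ s₀ β₀ α A B a τ σ : ℝ} {γ π : Fin (p - 1) → ℝ}
    {n m L : ℕ} {ψ : (Fin n → Obs p) → ℝ} (hM : 0 < M) (hA0 : 0 < A)
    (hB1 : 1 ≤ B) (hE : EigenvaluesBetween A B (bordered τ π)) (hA : M⁻¹ ≤ A - √(a * B))
    (hB : B + √(a * B) ≤ M) (ha : 0 < a) (ha1 : a ≤ 1) (hσ : 0 < σ) (hσM : σ ≤ M₁)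
    (hc : ‖(⟨β₀ + a, γ, bordered τ π, σ⟩ : Param p).coef‖ + a * √B + √(a * B) ≤ M₂)
    (hs : ((1 + supportSize π + m : ℕ) : ℝ) ≤ s₀) (hsmall : a * (1 + B / σ ^ 2) ≤ 1 / 2)
    (hm : 0 < m) (hL : 0 < L) {e : Fin m × Fin L → Fin (p - 1)} (he : Function.Injective e)
    (hπe : ∀ i, π (e i) = 0) (hψ : ψ ∈ tests n α (nullSpace p M M₁ M₂ s₀ β₀)) :
    power ψ (⟨β₀ + a, γ, bordered τ π, σ⟩ : Param p) ≤
      α + √(Real.exp (m * Real.exp (2 * n * (a * (1 + B / σ ^ 2)) / m) / L) - 1) := by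
  have hm' : (0 : ℝ) < m := by exact_mod_cast hm
  have hpsd := (hE.posDef hA0).posSemidef
  set v := τ - π ⬝ᵥ π with hv
  have hv0 : 0 < v := hA0.trans_le (by
    rw [hv, dotProduct_self_eq_sum_sq]; exact hE.le_schur hA0.le)
  have hvB : v ≤ B := by
    have h1 := hE.bordered_le
    have h2 : 0 ≤ π ⬝ᵥ π := by
      rw [dotProduct_self_eq_sum_sq]; exact Finset.sum_nonneg fun j _ => sq_nonneg _
    linarith
  -- Then m entries equal to b give ‖ξ J‖² = av.
  set b := √(a * v / m)
  have hb2 : b ^ 2 = a * v / m := Real.sq_sqrt (by positivity)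
  set ξ : (Fin m → Fin L) → Fin (p - 1) → ℝ := blockVec e b
  have hξξ : ∀ J K, ξ J ⬝ᵥ ξ K = a * v / m * agreement J K := fun J K => by
    rw [← hb2]; exact blockVec_dotProduct_blockVec he b J K
  have hξ : ∀ J, ξ J ⬝ᵥ ξ J = a * v := fun J => by
    rw [hξξ, agreement_self]; field_simp
  have hπξ : ∀ J, π ⬝ᵥ ξ J = 0 := fun J => by
    simp only [ξ]
    rw [dotProduct_blockVec]
    simp [hπe]
  have haB : √(a * B) ^ 2 = a * B := Real.sq_sqrt (by positivity)
  have hξB : ∀ J, ξ J ⬝ᵥ ξ J ≤ √(a * B) ^ 2 := fun J => by rw [hξ, haB]; gcongr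
  have hEξ : ∀ J, EigenvaluesBetween M⁻¹ M (bordered τ (π + ξ J)) := fun J =>
    hE.bordered_add (Real.sqrt_nonneg _)
      (by rw [← dotProduct_self_eq_sum_sq]; exact hξB J) hA hB
  -- the noise level of the null parameters
  have hav : a * v ≤ σ ^ 2 := by
    have h1 : a * (B / σ ^ 2) ≤ 1 := by nlinarith
    have h2 : a * B ≤ σ ^ 2 := by
      rw [← mul_div_assoc, div_le_one (by positivity)] at h1
      exact h1
    exact (mul_le_mul_of_nonneg_left hvB ha.le).trans h2
  have h1a : 0 ≤ 1 - a := by linarith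
  set σ' := √(σ ^ 2 - a * (1 - a) * v)
  have haav : a * (1 - a) * v ≤ a * v := by nlinarith [mul_pos (mul_pos ha ha) hv0]
  have hσ'2 : σ' ^ 2 = σ ^ 2 - a * (1 - a) * v := Real.sq_sqrt (by linarith)
  have hσ'σ : σ' ≤ σ := by
    refine (abs_le_of_sq_le_sq' ?_ hσ.le).2
    rw [hσ'2]
    have : 0 ≤ a * (1 - a) * v := by positivity
    linarith
  -- standardization
  set D := √(σ ^ 2 + (1 - a) ^ 2 * v)
  have hD2 : D ^ 2 = σ ^ 2 + (1 - a) ^ 2 * v := Real.sq_sqrt (by positivity)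
  have hD : 0 < D := Real.sqrt_pos.mpr (by positivity)
  have hsv : 0 < √v := Real.sqrt_pos.mpr hv0
  have hsv2 : √v ^ 2 = v := Real.sq_sqrt hv0.le
  -- Let R_Z and R_y be the residuals of Z and y - β₀Z given W under the alternative. Their
  -- difference has standard deviation D, and w = (R_Z - R_y) / D. Removing the w part from either
  -- leaves the same variable kg, since v₂ - e₂ = D.
  set k := √v * σ / D
  set v₂ := (1 - a) * v / D
  set e₂ := (a * (1 - a) * v - σ ^ 2) / D
  set q := D / (√v * σ)
  have hk2 : k ^ 2 = v * σ ^ 2 / D ^ 2 := by simp only [k]; rw [div_pow, mul_pow, hsv2]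
  have e1 : k ^ 2 + v₂ ^ 2 = v := by
    rw [hk2]; simp only [v₂]
    rw [div_pow, ← add_div, div_eq_iff (by positivity), hD2]; ring
  have e2 : k * k + v₂ * e₂ = a * v := by
    rw [← sq, hk2]; simp only [v₂, e₂]
    rw [div_mul_div_comm, ← sq, ← add_div, div_eq_iff (by positivity), hD2]; ring
  have e3 : k ^ 2 + e₂ ^ 2 = a ^ 2 * v + σ ^ 2 := by
    rw [hk2]; simp only [e₂]
    rw [div_pow, ← add_div, div_eq_iff (by positivity), hD2]; ring
  have hqk : q * k = 1 := by simp only [q, k]; field_simp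
  set r := q ^ 2 * (a * v)
  have hq2 : r = a * (1 + (1 - a) ^ 2 * v / σ ^ 2) := by
    simp only [r, q]; rw [div_pow, mul_pow, hsv2, hD2]; field_simp
  have hr0 : 0 ≤ r := by positivity
  have hrB : r ≤ a * (1 + B / σ ^ 2) := by
    rw [hq2]
    gcongr
    calc (1 - a) ^ 2 * v ≤ 1 * v := by
          gcongr; exact pow_le_one₀ h1a (by linarith)
      _ ≤ B := by linarith
  have hinner : ∀ J K, ⟪joinVec (p := p) 0 (q • ξ J), joinVec 0 (q • ξ K)⟫ =
      r / m * agreement J K := by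
    intro J K
    rw [inner_joinVec_joinVec, smul_dotProduct, dotProduct_smul, hξξ]
    simp only [r, smul_eq_mul]
    ring
  have hnorm : ∀ J, ‖joinVec (p := p) 0 (q • ξ J)‖ ^ 2 = r := fun J => by
    rw [← real_inner_self_eq_norm_sq, hinner, agreement_self]; field_simp
  have hr1 : r < 1 := by linarith
  -- The roles are reversed from the noise comparison: the alternative is the reference and the null
  -- parameters are the tilts, so the mixture is taken over the null.
  have h₀ := obsLaw_eq_map_of_untilted (β₀ := β₀) (γ := γ) hpsd e1 e2 e3
  have h₁ : ∀ J, obsLaw (⟨β₀, γ + a • π + ξ J, bordered τ (π + ξ J), σ'⟩ : Param p) = _ :=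
    fun J => obsLaw_eq_map_of_tilted_covariates
      ((hEξ J).posDef (inv_pos.mpr hM)).posSemidef ((hnorm J).trans_lt hr1) e1 e2 e3 hqk (hξ J)
      (hπξ J) hσ'2
  have hnull : ∀ J, power ψ (⟨β₀, γ + a • π + ξ J, bordered τ (π + ξ J), σ'⟩ : Param p) ≤ α := by
    refine fun J => hψ.2.2 _ (mem_nullSpace_of_bordered hM (hEξ J) (Real.sqrt_nonneg _)
      (hσ'σ.trans hσM) (norm_coef_le β₀ τ τ σ σ' γ π _ _ hA0.le hB1 ha.le (Real.sqrt_nonneg _)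
        hE (hξB J) hc) (le_trans ?_ hs))
    have h1 := supportSize_add_le π (ξ J)
    have h2 : supportSize (ξ J) ≤ m := card_support_blockVec_le e b J
    exact_mod_cast (by omega : 1 + supportSize (π + ξ J) ≤ 1 + supportSize π + m)
  have : Nonempty (Fin m → Fin L) := ⟨fun _ => ⟨0, hL⟩⟩
  have key := abs_average_power_sub_le (n := n) hr1 hnorm (measurable_linearObs _ _ _ _ _ _ _)
    h₀ h₁ hψ.1 hψ.2.1
  have hcard : (0 : ℝ) < Fintype.card (Fin m → Fin L) := by exact_mod_cast Fintype.card_pos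
  have havg : (∑ J, power ψ (⟨β₀, γ + a • π + ξ J, bordered τ (π + ξ J), σ'⟩ : Param p)) /
      Fintype.card (Fin m → Fin L) ≤ α := by
    rw [div_le_iff₀ hcard]
    refine (Finset.sum_le_sum fun J _ => hnull J).trans ?_
    rw [Finset.sum_const, Finset.card_univ, nsmul_eq_mul, mul_comm]
  have hle : ∀ J K : Fin m → Fin L, (1 / (1 - ⟪joinVec (p := p) 0 (q • ξ J),
      joinVec 0 (q • ξ K)⟫)) ^ n ≤
      Real.exp (2 * n * (a * (1 + B / σ ^ 2)) / m * agreement J K) := by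
    intro J K
    have hag : (agreement J K : ℝ) ≤ m := by exact_mod_cast agreement_le J K
    rw [hinner]
    refine (inv_one_sub_pow_le_exp (by positivity) ?_ n).trans (Real.exp_le_exp.mpr ?_)
    · calc r / m * agreement J K ≤ r / m * m := by gcongr
        _ = r := by field_simp
        _ ≤ 1 / 2 := by linarith
    · calc 2 * n * (r / m * agreement J K) = 2 * n * r / m * agreement J K := by ring
        _ ≤ _ := by gcongr
  have hfin : (∑ J, ∑ K, (1 / (1 - ⟪joinVec (p := p) 0 (q • ξ J),
      joinVec 0 (q • ξ K)⟫)) ^ n) / (Fintype.card (Fin m → Fin L) : ℝ) ^ 2 ≤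
      Real.exp (m * Real.exp (2 * n * (a * (1 + B / σ ^ 2)) / m) / L) := by
    refine le_trans ?_ (average_exp_agreement_le hL _)
    gcongr with J _ K _
    exact hle J K
  have h5 := (abs_le.mp key).1
  have h6 := Real.sqrt_le_sqrt (sub_le_sub_right hfin 1)
  linarith

end PowerComparison

/-! ### What the entries of ρ guarantee -/

section Constants

variable {M M₁ M₂ ζ κ c a : ℝ}

lemma rho_nonneg (hM : 1 < M) (hM₂ : 0 < M₂) (hζ : M⁻¹ < ζ) (hζ' : ζ < 1) (hc : c < 1 / 2) :
    0 ≤ rho M M₁ M₂ ζ κ c := by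
  have hM0 : 0 < M := by linarith
  have hζ0 : 0 < ζ := (inv_pos.mpr hM0).trans hζ
  have h1 : 0 < 1 - ζ ^ 2 := by nlinarith
  have h2 : 0 < 1 / 2 - c := by linarith
  unfold rho
  simp only [le_min_iff]
  refine ⟨by norm_num, ?_, ?_, ?_, ?_, ?_, ?_, ?_⟩ <;> positivity

/-- The second entry of `rho` bounds the squared length of the tilts, uniformly over σ ≥ κ. -/
lemma mul_one_add_le_of_le_rho {t σ : ℝ} (hM : 1 < M) (hζ : M⁻¹ < ζ) (hζ' : ζ < 1) (hκ : 0 < κ)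
    (hσ : κ ≤ σ) (ht : 0 ≤ t) (ha : 0 ≤ a) (hat : a ≤ rho M M₁ M₂ ζ κ c * t) :
    a * (1 + ζ * M / σ ^ 2) ≤ (1 / 2 - c) / 15 * t := by
  have hM0 : 0 < M := by linarith
  have hζ0 : 0 < ζ := (inv_pos.mpr hM0).trans hζ
  have hrho : rho M M₁ M₂ ζ κ c ≤ (1 / 2 - c) / (15 * ((κ ^ 2)⁻¹ * M + 1)) := by
    unfold rho; exact (min_le_right _ _).trans (min_le_left _ _)
  have h1 : 1 + ζ * M / σ ^ 2 ≤ (κ ^ 2)⁻¹ * M + 1 := by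
    have : ζ * M / σ ^ 2 ≤ 1 * M / κ ^ 2 := by gcongr
    rw [one_mul, div_eq_inv_mul M] at this
    linarith
  have h2 : 0 < (κ ^ 2)⁻¹ * M + 1 := by positivity
  calc a * (1 + ζ * M / σ ^ 2)
      ≤ ((1 / 2 - c) / (15 * ((κ ^ 2)⁻¹ * M + 1)) * t) * ((κ ^ 2)⁻¹ * M + 1) := by
        have h3 : a ≤ (1 / 2 - c) / (15 * ((κ ^ 2)⁻¹ * M + 1)) * t :=
          hat.trans (by gcongr)
        exact mul_le_mul h3 h1 (by positivity) (ha.trans h3)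
    _ = _ := by field_simp

lemma le_one_of_le_rho (ha4 : a ≤ rho M M₁ M₂ ζ κ c / 4) : a ≤ 1 := by
  have : rho M M₁ M₂ ζ κ c ≤ 4 := by unfold rho; exact min_le_left _ _
  linarith

/-- The third and fourth entries of `rho` fit the spectral perturbation √(aζM) between the bounds
for the alternative and those for the null. The factor 1/4 in the bound on a comes from s log p / n
≤ 1/4. -/
lemma eigenvalue_margin (hM : 1 < M) (hζ : M⁻¹ < ζ) (hζ' : ζ < 1) (ha : 0 ≤ a)
    (ha4 : a ≤ rho M M₁ M₂ ζ κ c / 4) :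
    M⁻¹ ≤ (ζ * M)⁻¹ - √(a * (ζ * M)) ∧ ζ * M + √(a * (ζ * M)) ≤ M := by
  have hM0 : 0 < M := by linarith
  have hζ0 : 0 < ζ := (inv_pos.mpr hM0).trans hζ
  have hr3 : rho M M₁ M₂ ζ κ c ≤ 2 * (ζ⁻¹ - 1) ^ 2 / (M ^ 3 * (2 * M + 1)) := by
    unfold rho
    exact (min_le_right _ _).trans <| (min_le_right _ _).trans <| min_le_left _ _
  have hr4 : rho M M₁ M₂ ζ κ c ≤ 2 * M * (1 - ζ) ^ 2 / (2 * M + 1) := by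
    unfold rho
    exact (min_le_right _ _).trans <| (min_le_right _ _).trans <| (min_le_right _ _).trans <|
      min_le_left _ _
  have haM : a * (ζ * M) ≤ a * M := by
    have : 0 ≤ a * M * (1 - ζ) := mul_nonneg (by positivity) (by linarith)
    nlinarith
  have hζi : 1 ≤ ζ⁻¹ := (one_le_inv₀ hζ0).mpr hζ'.le
  constructor
  · have h1 : √(a * (ζ * M)) ≤ M⁻¹ * (ζ⁻¹ - 1) := by
      refine Real.sqrt_le_iff.mpr ⟨mul_nonneg (by positivity) (by linarith), haM.trans ?_⟩
      have h2 : a ≤ 2 * (ζ⁻¹ - 1) ^ 2 / (M ^ 3 * (2 * M + 1)) / 4 := by linarith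
      calc a * M ≤ 2 * (ζ⁻¹ - 1) ^ 2 / (M ^ 3 * (2 * M + 1)) / 4 * M := by gcongr
        _ = (M⁻¹ * (ζ⁻¹ - 1)) ^ 2 * (1 / (2 * (2 * M + 1))) := by field_simp; ring
        _ ≤ (M⁻¹ * (ζ⁻¹ - 1)) ^ 2 * 1 := by
          gcongr
          rw [div_le_one (by positivity)]
          linarith
        _ = _ := mul_one _
    rw [mul_inv]
    linarith
  · have h1 : √(a * (ζ * M)) ≤ (1 - ζ) * M := by
      refine Real.sqrt_le_iff.mpr ⟨mul_nonneg (by linarith) hM0.le, haM.trans ?_⟩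
      have h2 : a ≤ 2 * M * (1 - ζ) ^ 2 / (2 * M + 1) / 4 := by linarith
      calc a * M ≤ 2 * M * (1 - ζ) ^ 2 / (2 * M + 1) / 4 * M := by gcongr
        _ = ((1 - ζ) * M) ^ 2 * (1 / (2 * (2 * M + 1))) := by field_simp; ring
        _ ≤ ((1 - ζ) * M) ^ 2 * 1 := by
          gcongr
          rw [div_le_one (by positivity)]
          linarith
        _ = _ := mul_one _
    linarith

/-- The last four entries of `rho` keep each of the two increments below half of the margin (1 -
ζ)M₂. -/
lemma coef_margin (hM : 1 < M) (hM₁ : 0 < M₁) (hM₂ : 0 < M₂) (hζ : M⁻¹ < ζ) (hζ' : ζ < 1)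
    (hκ : 0 < κ) (hκ' : κ < ζ * M₁) (ha : 0 ≤ a) (ha4 : a ≤ rho M M₁ M₂ ζ κ c / 4) :
    ζ * M₂ + a * √(ζ * M) + √(a * (ζ * M)) ≤ M₂ := by
  have hM0 : 0 < M := by linarith
  have hζ0 : 0 < ζ := (inv_pos.mpr hM0).trans hζ
  have h1ζ : 0 < 1 - ζ := by linarith
  have h1ζ2 : 0 < 1 - ζ ^ 2 := by nlinarith
  have hr5 : rho M M₁ M₂ ζ κ c ≤ (1 - ζ ^ 2) * M₂ / (8 * ζ * √M) := by
    unfold rho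
    exact (min_le_right _ _).trans <| (min_le_right _ _).trans <| (min_le_right _ _).trans <|
      (min_le_right _ _).trans <| min_le_left _ _
  have hr6 : rho M M₁ M₂ ζ κ c ≤
      κ ^ 2 * (1 - ζ ^ 2) ^ 2 * M₂ ^ 2 / (64 * ζ ^ 4 * M * M₁ ^ 2) := by
    unfold rho
    exact (min_le_right _ _).trans <| (min_le_right _ _).trans <| (min_le_right _ _).trans <|
      (min_le_right _ _).trans <| (min_le_right _ _).trans <| min_le_left _ _
  have hr7 : rho M M₁ M₂ ζ κ c ≤ M₂ * √(1 - ζ ^ 2) / (2 * √M) := by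
    unfold rho
    exact (min_le_right _ _).trans <| (min_le_right _ _).trans <| (min_le_right _ _).trans <|
      (min_le_right _ _).trans <| (min_le_right _ _).trans <| (min_le_right _ _).trans <|
      min_le_left _ _
  have hr8 : rho M M₁ M₂ ζ κ c ≤ κ ^ 2 * (1 - ζ ^ 2) * M₂ ^ 2 / (4 * ζ ^ 2 * M₁ ^ 2 * M) := by
    unfold rho
    exact (min_le_right _ _).trans <| (min_le_right _ _).trans <| (min_le_right _ _).trans <|
      (min_le_right _ _).trans <| (min_le_right _ _).trans <| (min_le_right _ _).trans <|
      min_le_right _ _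
  have hκ2 : κ ^ 2 ≤ (ζ * M₁) ^ 2 := by gcongr
  -- bounds for the squares of the two increments
  have b5 : a ^ 2 * (ζ * M) ≤ ((1 - ζ ^ 2) * M₂) ^ 2 / (1024 * ζ) := by
    have h : a ≤ (1 - ζ ^ 2) * M₂ / (8 * ζ * √M) / 4 := by linarith
    calc a ^ 2 * (ζ * M) ≤ ((1 - ζ ^ 2) * M₂ / (8 * ζ * √M) / 4) ^ 2 * (ζ * M) := by gcongr
      _ = ((1 - ζ ^ 2) * M₂) ^ 2 / (1024 * ζ ^ 2 * √M ^ 2) * (ζ * M) := by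
        field_simp; norm_num
      _ = _ := by rw [Real.sq_sqrt hM0.le]; field_simp
  have b7 : a ^ 2 * (ζ * M) ≤ ζ * M₂ ^ 2 / 64 := by
    have h : a ≤ M₂ * √(1 - ζ ^ 2) / (2 * √M) / 4 := by linarith
    calc a ^ 2 * (ζ * M) ≤ (M₂ * √(1 - ζ ^ 2) / (2 * √M) / 4) ^ 2 * (ζ * M) := by gcongr
      _ = M₂ ^ 2 * √(1 - ζ ^ 2) ^ 2 / (64 * √M ^ 2) * (ζ * M) := by
        field_simp; norm_num
      _ = ζ * M₂ ^ 2 / 64 * (1 - ζ ^ 2) := by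
        rw [Real.sq_sqrt hM0.le, Real.sq_sqrt h1ζ2.le]; field_simp
      _ ≤ ζ * M₂ ^ 2 / 64 * 1 := by
        gcongr
        linarith [sq_nonneg ζ]
      _ = _ := mul_one _
  have b6 : a * (ζ * M) ≤ ((1 - ζ ^ 2) * M₂) ^ 2 / (256 * ζ) := by
    have h : a ≤ κ ^ 2 * (1 - ζ ^ 2) ^ 2 * M₂ ^ 2 / (64 * ζ ^ 4 * M * M₁ ^ 2) / 4 := by linarith
    calc a * (ζ * M) ≤
          κ ^ 2 * (1 - ζ ^ 2) ^ 2 * M₂ ^ 2 / (64 * ζ ^ 4 * M * M₁ ^ 2) / 4 * (ζ * M) := by gcongr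
      _ ≤ (ζ * M₁) ^ 2 * (1 - ζ ^ 2) ^ 2 * M₂ ^ 2 / (64 * ζ ^ 4 * M * M₁ ^ 2) / 4 * (ζ * M) := by
        gcongr
      _ = _ := by field_simp; norm_num
  have b8 : a * (ζ * M) ≤ ζ * M₂ ^ 2 / 16 := by
    have h : a ≤ κ ^ 2 * (1 - ζ ^ 2) * M₂ ^ 2 / (4 * ζ ^ 2 * M₁ ^ 2 * M) / 4 := by linarith
    calc a * (ζ * M) ≤
          κ ^ 2 * (1 - ζ ^ 2) * M₂ ^ 2 / (4 * ζ ^ 2 * M₁ ^ 2 * M) / 4 * (ζ * M) := by gcongr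
      _ ≤ (ζ * M₁) ^ 2 * (1 - ζ ^ 2) * M₂ ^ 2 / (4 * ζ ^ 2 * M₁ ^ 2 * M) / 4 * (ζ * M) := by
        gcongr
      _ = ζ * M₂ ^ 2 / 16 * (1 - ζ ^ 2) := by field_simp; norm_num
      _ ≤ ζ * M₂ ^ 2 / 16 * 1 := by
        gcongr
        linarith [sq_nonneg ζ]
      _ = _ := mul_one _
  set H := (1 - ζ) * M₂ / 2 with hH
  have hH0 : 0 ≤ H := by positivity
  have hsq : a ^ 2 * (ζ * M) ≤ H ^ 2 ∧ a * (ζ * M) ≤ H ^ 2 := by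
    -- `b5` and `b6` carry the factor 1/ζ and serve ζ away from 0; `b7` and `b8` carry the factor ζ
    -- but no power of 1 - ζ and serve small ζ.
    rcases le_total (1 / 16) ζ with hcase | hcase
    · have h1 : ((1 - ζ ^ 2) * M₂) ^ 2 ≤ 16 * H ^ 2 := by
        have : ((1 - ζ ^ 2) * M₂) ^ 2 = (1 + ζ) ^ 2 * (4 * H ^ 2) := by rw [hH]; ring
        rw [this]
        have h2 : (1 + ζ) ^ 2 ≤ 2 ^ 2 := by gcongr; linarith
        have h3 : (1 + ζ) ^ 2 * (4 * H ^ 2) ≤ 2 ^ 2 * (4 * H ^ 2) := by gcongr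
        linarith
      have h2 : H ^ 2 * 16 ≤ H ^ 2 * (256 * ζ) := by gcongr; linarith
      have h3 : H ^ 2 * (256 * ζ) ≤ H ^ 2 * (1024 * ζ) := by gcongr; norm_num
      constructor
      · refine b5.trans ?_
        rw [div_le_iff₀ (by positivity)]
        linarith
      · refine b6.trans ?_
        rw [div_le_iff₀ (by positivity)]
        linarith
    · have h1 : (15 / 32) ^ 2 * M₂ ^ 2 ≤ H ^ 2 := by
        rw [← mul_pow]
        gcongr
        have := mul_le_mul_of_nonneg_right hcase hM₂.le
        rw [hH]
        linarith
      have h2 : ζ * M₂ ^ 2 ≤ 1 / 16 * M₂ ^ 2 := by gcongr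
      have h3 : 0 ≤ M₂ ^ 2 := sq_nonneg _
      constructor <;> linarith
  have h1 : a * √(ζ * M) ≤ H := by
    have : a * √(ζ * M) = √(a ^ 2 * (ζ * M)) := by
      rw [Real.sqrt_mul (sq_nonneg a), Real.sqrt_sq ha]
    rw [this]
    exact Real.sqrt_le_iff.mpr ⟨hH0, hsq.1⟩
  have h2 : √(a * (ζ * M)) ≤ H := Real.sqrt_le_iff.mpr ⟨hH0, hsq.2⟩
  rw [hH] at h1 h2
  linarith

end Constants

/-! ### Consequences of 2 ≤ s ≤ p^c -/

section Growth

variable {p s : ℕ} {c : ℝ}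

lemma exponent_pos_of_le_rpow (hs : 2 ≤ s) (hsp : (s : ℝ) ≤ (p : ℝ) ^ c) : 0 < c := by
  by_contra! hc
  have hs' : (2 : ℝ) ≤ s := by exact_mod_cast hs
  have : (p : ℝ) ^ c ≤ 1 := by
    rcases Nat.eq_zero_or_pos p with rfl | hp
    · exact_mod_cast Real.zero_rpow_le_one c
    · exact Real.rpow_le_one_of_one_le_of_nonpos (by exact_mod_cast hp) hc
  linarith

lemma one_le_of_le_rpow (hs : 2 ≤ s) (hsp : (s : ℝ) ≤ (p : ℝ) ^ c) : 1 ≤ p := by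
  by_contra! hp
  have hs' : (2 : ℝ) ≤ s := by exact_mod_cast hs
  have hp0 : p = 0 := by omega
  have hc0 := exponent_pos_of_le_rpow hs hsp
  rw [hp0, Nat.cast_zero, Real.zero_rpow hc0.ne'] at hsp
  linarith

lemma le_of_le_rpow (hc : c < 1 / 2) (hs : 2 ≤ s) (hsp : (s : ℝ) ≤ (p : ℝ) ^ c) : s ≤ p := by
  have hp : (1 : ℝ) ≤ p := by exact_mod_cast one_le_of_le_rpow hs hsp
  have := Real.rpow_le_rpow_of_exponent_le hp (show c ≤ 1 by linarith)
  rw [Real.rpow_one] at this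
  exact_mod_cast hsp.trans this

/-- Here m / L ≤ s² / p ≤ p^(2c - 1), and eˣ costs only half of this exponent. -/
lemma mixture_exponent_le (hc : c < 1 / 2) (hs : 2 ≤ s) (hsp : (s : ℝ) ≤ (p : ℝ) ^ c) {x : ℝ}
    (hx : x ≤ (1 / 2 - c) * Real.log p) :
    ((s / 2 : ℕ) : ℝ) * Real.exp x / ((p / (2 * (s / 2)) : ℕ) : ℝ) ≤ (p : ℝ) ^ (-(1 / 2 - c)) := by
  have hp0 : 1 ≤ p := one_le_of_le_rpow hs hsp
  have hp : (0 : ℝ) < p := by exact_mod_cast hp0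
  have hspn : s ≤ p := le_of_le_rpow hc hs hsp
  set m := s / 2
  set L := p / (2 * m)
  have hm : 1 ≤ m := by omega
  have hms : 2 * m ≤ s := by omega
  have hL : 1 ≤ L := (Nat.one_le_div_iff (by omega)).mpr (hms.trans hspn)
  -- Since L ≥ 1, rounding down in L loses at most a factor 2.
  have hpL : p ≤ 4 * m * L := by
    have h1 : p < 2 * m * (L + 1) := by
      have := Nat.lt_mul_div_succ p (show 0 < 2 * m by omega)
      simpa [L] using this
    nlinarith
  have hL' : (0 : ℝ) < L := by exact_mod_cast hL
  have hpL' : (p : ℝ) ≤ 4 * m * L := by exact_mod_cast hpL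
  have hms' : 2 * (m : ℝ) ≤ s := by exact_mod_cast hms
  have h1 : (m : ℝ) / L ≤ (p : ℝ) ^ (-(2 * (1 / 2 - c))) := by
    have h2 : (m : ℝ) / L ≤ (s : ℝ) ^ 2 / p := by
      rw [div_le_div_iff₀ hL' hp]
      calc (m : ℝ) * p ≤ m * (4 * m * L) := by gcongr
        _ = (2 * m) ^ 2 * L := by ring
        _ ≤ _ := by gcongr
    have h3 : (s : ℝ) ^ 2 ≤ (p : ℝ) ^ (2 * c) := by
      calc (s : ℝ) ^ 2 ≤ ((p : ℝ) ^ c) ^ 2 := by gcongr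
        _ = _ := by rw [← Real.rpow_natCast, ← Real.rpow_mul hp.le]; push_cast; ring_nf
    calc (m : ℝ) / L ≤ (s : ℝ) ^ 2 / p := h2
      _ ≤ (p : ℝ) ^ (2 * c) / p := by gcongr
      _ = (p : ℝ) ^ (2 * c - 1) := by rw [Real.rpow_sub_one hp.ne']
      _ = _ := by ring_nf
  have h4 : Real.exp x ≤ (p : ℝ) ^ (1 / 2 - c) := by
    rw [Real.rpow_def_of_pos hp]
    exact Real.exp_le_exp.mpr (by linarith)
  calc (m : ℝ) * Real.exp x / L = m / L * Real.exp x := by ring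
    _ ≤ (p : ℝ) ^ (-(2 * (1 / 2 - c))) * (p : ℝ) ^ (1 / 2 - c) := by gcongr
    _ = _ := by rw [← Real.rpow_add hp]; ring_nf

lemma exists_injective_blocks {m L : ℕ} {π : Fin (p - 1) → ℝ}
    (h : m * L + supportSize π ≤ p - 1) :
    ∃ e : Fin m × Fin L → Fin (p - 1), Function.Injective e ∧ ∀ i, π (e i) = 0 := by
  have hcard : Fintype.card (Fin m × Fin L) ≤ Fintype.card {j // π j = 0} := by
    have h1 := Finset.card_filter_add_card_filter_not
      (s := (Finset.univ : Finset (Fin (p - 1)))) (fun j => π j = 0)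
    rw [Fintype.card_subtype, Fintype.card_prod, Fintype.card_fin, Fintype.card_fin]
    simp only [Finset.card_univ, Fintype.card_fin] at h1
    have h2 : supportSize π = (Finset.univ.filter fun j => ¬ π j = 0).card := rfl
    omega
  obtain ⟨f⟩ := Function.Embedding.nonempty_of_card_le hcard
  exact ⟨fun i => (f i).1, Subtype.val_injective.comp f.injective, fun i => (f i).2⟩

end Growth

/-! ### Power bounds for large and for bounded dimension -/

section PowerBounds

variable {M M₁ M₂ ζ κ c α β₀ : ℝ} {p s n : ℕ} {ψ : (Fin n → Obs p) → ℝ} {θ : Param p}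

lemma power_le_of_large_dimension (hM : 1 < M) (hM₁ : 0 < M₁) (hM₂ : 0 < M₂) (hζ : M⁻¹ < ζ)
    (hζ' : ζ < 1) (hκ : 0 < κ) (hκ' : κ < ζ * M₁) (hc : c < 1 / 2) (hn : 0 < n)
    (hsn : (s : ℝ) * Real.log p / n ≤ 1 / 4) (hs : 2 ≤ s) (hsp : (s : ℝ) ≤ (p : ℝ) ^ c)
    (hψ : ψ ∈ tests n α (nullSpace p M M₁ M₂ s β₀))
    (hθ : θ ∈ altSpace p M M₁ M₂ ζ κ ((s : ℝ) / 2) β₀ (radius M M₁ M₂ ζ κ c s p n)) :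
    power ψ θ ≤ α + √(Real.exp ((p : ℝ) ^ (-(1 / 2 - c))) - 1) := by
  have hM0 : 0 < M := by linarith
  have hζ0 : 0 < ζ := (inv_pos.mpr hM0).trans hζ
  have hζM : 1 < ζ * M := (inv_lt_iff_one_lt_mul₀ hM0).mp hζ
  have hc0 := exponent_pos_of_le_rpow hs hsp
  have hp1 := one_le_of_le_rpow hs hsp
  have hspn := le_of_le_rpow hc hs hsp
  have hlog : 0 ≤ Real.log p := Real.log_natCast_nonneg p
  have hn' : (0 : ℝ) < n := by exact_mod_cast hn
  obtain ⟨a, τ, σ, γ, π, rfl, ha0, hah, hE, hσ, hσ', hcf, hsup⟩ := exists_eq_of_mem_altSpace hM hθ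
  have hrho := rho_nonneg (κ := κ) (M₁ := M₁) hM hM₂ hζ hζ' hc
  have ht : 0 ≤ (s : ℝ) * Real.log p / n := by positivity
  have ha4 : a ≤ rho M M₁ M₂ ζ κ c / 4 := by
    have := mul_le_mul_of_nonneg_left hsn hrho
    rw [radius] at hah
    linarith
  have hσ0 : 0 < σ := hκ.trans_le hσ
  have hσM : σ ≤ M₁ := hσ'.trans (by nlinarith)
  have hA0 : 0 < (ζ * M)⁻¹ := inv_pos.mpr (by linarith)
  have hcoef := coef_margin hM hM₁ hM₂ hζ hζ' hκ hκ' ha0 ha4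
  -- The real bound s / 2 rounds down, leaving ⌊s/2⌋ further entries within the null sparsity s.
  have hsup2 : 1 + supportSize π ≤ s / 2 := by
    have : (((1 + supportSize π) * 2 : ℕ) : ℝ) ≤ s := by push_cast at hsup ⊢; linarith
    have : (1 + supportSize π) * 2 ≤ s := by exact_mod_cast this
    omega
  -- For a = 0 the alternative itself satisfies the null hypothesis, and the noise comparison is
  -- lossless.
  rcases ha0.eq_or_lt with rfl | ha
  · have hsmall : (0 : ℝ) ^ 2 * (ζ * M) / σ ^ 2 = 0 := by simp
    have h := power_le_of_tilted_noise (a := 0) (M := M) (M₁ := M₁) (M₂ := M₂) (s₀ := s) (β₀ := β₀)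
      (α := α) (γ := γ) (ψ := ψ) hM0 (inv_anti₀ (by linarith) (by nlinarith)) hζM.le (by nlinarith)
      hE le_rfl hσ0 (by rw [zero_pow two_ne_zero, zero_mul, add_zero]; gcongr) hM₁.le
      (by rw [zero_mul, add_zero]; exact hcf.trans (by nlinarith))
      (by exact_mod_cast hsup2.trans (Nat.div_le_self _ _)) (by rw [hsmall]; norm_num) hψ
    rw [hsmall, mul_zero, Real.exp_zero, sub_self, Real.sqrt_zero] at h
    linarith [Real.sqrt_nonneg (Real.exp ((p : ℝ) ^ (-(1 / 2 - c))) - 1)]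
  · have hm : 0 < s / 2 := by omega
    have hL : 0 < p / (2 * (s / 2)) := Nat.div_pos (by omega) (by omega)
    -- The blocks take at most half of the coordinates; the support of π, at most s / 2 - 1 ≤ p / 2
    -- - 1, fits in the rest.
    have hmL : s / 2 * (p / (2 * (s / 2))) ≤ p / 2 := by
      have h1 := Nat.mul_div_le p (2 * (s / 2))
      rw [Nat.le_div_iff_mul_le (by norm_num)]
      calc s / 2 * (p / (2 * (s / 2))) * 2 = 2 * (s / 2) * (p / (2 * (s / 2))) := by ring
        _ ≤ p := h1
    obtain ⟨e, he, hπe⟩ := exists_injective_blocks (m := s / 2) (L := p / (2 * (s / 2)))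
      (π := π) (by omega)
    have hT := mul_one_add_le_of_le_rho (σ := σ) hM hζ hζ' hκ hσ ht ha0 hah
    obtain ⟨hE1, hE2⟩ := eigenvalue_margin hM hζ hζ' ha0 ha4
    have h := power_le_of_tilted_covariates (M := M) (M₁ := M₁) (M₂ := M₂) (s₀ := s) (β₀ := β₀)
      (α := α) (γ := γ) (ψ := ψ) hM0 hA0 hζM.le hE hE1 hE2 ha (le_one_of_le_rho ha4) hσ0 hσM
      (by linarith) (by exact_mod_cast (by omega : 1 + supportSize π + s / 2 ≤ s))
      (hT.trans (by nlinarith)) hm hL he hπe hψ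
    refine h.trans ?_
    gcongr
    refine mixture_exponent_le hc hs hsp ?_
    have hm' : (0 : ℝ) < ((s / 2 : ℕ) : ℝ) := by exact_mod_cast hm
    -- The worst case is s = 3. With the 15 in `rho`, the resulting factor is 2/15 · 3 = 2/5 < 1.
    have hs3 : (s : ℝ) ≤ 3 * ((s / 2 : ℕ) : ℝ) := by exact_mod_cast (by omega : s ≤ 3 * (s / 2))
    rw [div_le_iff₀ hm']
    have hη : 0 ≤ 1 / 2 - c := by linarith
    calc 2 * (n : ℝ) * (a * (1 + ζ * M / σ ^ 2))
        ≤ 2 * n * ((1 / 2 - c) / 15 * (s * Real.log p / n)) := by gcongr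
      _ = 2 / 15 * ((1 / 2 - c) * Real.log p) * s := by field_simp
      _ ≤ 2 / 15 * ((1 / 2 - c) * Real.log p) * (3 * ((s / 2 : ℕ) : ℝ)) := by gcongr
      _ = 2 / 5 * ((1 / 2 - c) * Real.log p * ((s / 2 : ℕ) : ℝ)) := by ring
      _ ≤ 1 * ((1 / 2 - c) * Real.log p * ((s / 2 : ℕ) : ℝ)) := by gcongr; norm_num
      _ = _ := one_mul _

/-- For p ≤ P the radius gives a ≤ 4P² / n, so na² = O(1/n). The inflated noise stays below M₁
because σ ≤ ζM₁ leaves (1 - ζ²)M₁² for the variance. -/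
lemma power_le_of_bounded_dimension {P : ℕ} (hM : 1 < M) (hM₁ : 0 < M₁) (hM₂ : 0 < M₂)
    (hζ : M⁻¹ < ζ) (hζ' : ζ < 1) (hκ : 0 < κ) (hκ' : κ < ζ * M₁) (hc : c < 1 / 2) (hn : 0 < n)
    (hsn : (s : ℝ) * Real.log p / n ≤ 1 / 4) (hs : 2 ≤ s) (hsp : (s : ℝ) ≤ (p : ℝ) ^ c)
    (hP : p ≤ P) (hn1 : 16 * P ^ 4 * M / n ≤ (1 - ζ ^ 2) * M₁ ^ 2)
    (hn2 : 16 * P ^ 4 * M / κ ^ 2 / n ≤ 1 / 2)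
    (hψ : ψ ∈ tests n α (nullSpace p M M₁ M₂ s β₀))
    (hθ : θ ∈ altSpace p M M₁ M₂ ζ κ ((s : ℝ) / 2) β₀ (radius M M₁ M₂ ζ κ c s p n)) :
    power ψ θ ≤ α + √(Real.exp (2 * (16 * P ^ 4 * M / κ ^ 2) / n) - 1) := by
  have hM0 : 0 < M := by linarith
  have hζ0 : 0 < ζ := (inv_pos.mpr hM0).trans hζ
  have hζM : 1 < ζ * M := (inv_lt_iff_one_lt_mul₀ hM0).mp hζ
  have hspn := le_of_le_rpow hc hs hsp
  have hlog : 0 ≤ Real.log p := Real.log_natCast_nonneg p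
  have hn' : (1 : ℝ) ≤ n := by exact_mod_cast hn
  obtain ⟨a, τ, σ, γ, π, rfl, ha0, hah, hE, hσ, hσ', hcf, hsup⟩ := exists_eq_of_mem_altSpace hM hθ
  have hrho := rho_nonneg (κ := κ) (M₁ := M₁) hM hM₂ hζ hζ' hc
  have ha4 : a ≤ rho M M₁ M₂ ζ κ c / 4 := by
    have := mul_le_mul_of_nonneg_left hsn hrho
    rw [radius] at hah
    linarith
  have hσ0 : 0 < σ := hκ.trans_le hσ
  have hcoef := coef_margin hM hM₁ hM₂ hζ hζ' hκ hκ' ha0 ha4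
  have haP : a ≤ 4 * P ^ 2 / n := by
    have hr4 : rho M M₁ M₂ ζ κ c ≤ 4 := by unfold rho; exact min_le_left _ _
    have hP' : (p : ℝ) ≤ P := by exact_mod_cast hP
    have hsP : (s : ℝ) ≤ P := by exact_mod_cast hspn.trans hP
    have hlP : Real.log p ≤ P := (Real.log_le_self (Nat.cast_nonneg p)).trans hP'
    calc a ≤ rho M M₁ M₂ ζ κ c * (s * Real.log p / n) := hah
      _ ≤ 4 * (P * P / n) := by gcongr
      _ = _ := by ring
  have haB : a ^ 2 * (ζ * M) ≤ 16 * P ^ 4 * M / n ^ 2 := by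
    calc a ^ 2 * (ζ * M) ≤ (4 * P ^ 2 / n) ^ 2 * (1 * M) := by gcongr
      _ = _ := by ring
  have hnn : (n : ℝ) ≤ n ^ 2 := by nlinarith
  have haBσ : a ^ 2 * (ζ * M) / σ ^ 2 ≤ 16 * P ^ 4 * M / κ ^ 2 / n ^ 2 := by
    calc a ^ 2 * (ζ * M) / σ ^ 2 ≤ 16 * P ^ 4 * M / n ^ 2 / κ ^ 2 := by gcongr
      _ = _ := by ring
  have h := power_le_of_tilted_noise (a := a) (M := M) (M₁ := M₁) (M₂ := M₂) (s₀ := s) (β₀ := β₀)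
    (α := α) (γ := γ) (ψ := ψ) hM0 (inv_anti₀ (by linarith) (by nlinarith)) hζM.le (by nlinarith)
    hE ha0 hσ0 ?_ hM₁.le ?_ ?_ ?_ hψ
  · refine h.trans ?_
    gcongr
    calc 2 * (n : ℝ) * (a ^ 2 * (ζ * M) / σ ^ 2)
        ≤ 2 * n * (16 * P ^ 4 * M / κ ^ 2 / n ^ 2) := by gcongr
      _ = _ := by field_simp
  · have h1 : σ ^ 2 ≤ (ζ * M₁) ^ 2 := by gcongr
    have h2 : 16 * P ^ 4 * M / (n : ℝ) ^ 2 ≤ 16 * P ^ 4 * M / n := by gcongr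
    have h3 : (ζ * M₁) ^ 2 + (1 - ζ ^ 2) * M₁ ^ 2 = M₁ ^ 2 := by ring
    linarith
  · have := Real.sqrt_nonneg (a * (ζ * M))
    linarith
  · have : (0 : ℝ) ≤ s := Nat.cast_nonneg s
    linarith
  · refine haBσ.trans (le_trans ?_ hn2)
    gcongr

end PowerBounds

/-- Uniform bound for the powers of all level `α` tests at all alternatives. -/
theorem eventually_power_le {M M₁ M₂ ζ κ c α β₀ : ℝ} (hM : 1 < M) (hM₁ : 0 < M₁) (hM₂ : 0 < M₂)
    (hζ : M⁻¹ < ζ) (hζ' : ζ < 1) (hκ : 0 < κ) (hκ' : κ < ζ * M₁) (hc : c < 1 / 2) {p s : ℕ → ℕ}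
    (hsn : ∀ᶠ n : ℕ in atTop, (s n : ℝ) * Real.log (p n) / n ≤ 1 / 4)
    (hs : ∀ᶠ n : ℕ in atTop, 2 ≤ s n) (hsp : ∀ᶠ n : ℕ in atTop, (s n : ℝ) ≤ (p n : ℝ) ^ c)
    {ε : ℝ} (hε : 0 < ε) :
    ∀ᶠ n : ℕ in atTop, ∀ ψ ∈ tests n α (nullSpace (p n) M M₁ M₂ (s n) β₀),
      ∀ θ ∈ altSpace (p n) M M₁ M₂ ζ κ ((s n : ℝ) / 2) β₀
        (radius M M₁ M₂ ζ κ c (s n) (p n) n), power ψ θ ≤ α + ε := by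
  have hη : 0 < 1 / 2 - c := by linarith
  have hlim : Tendsto (fun x : ℝ => √(Real.exp x - 1)) (𝓝 0) (𝓝 0) := by
    have : Continuous fun x : ℝ => √(Real.exp x - 1) := by fun_prop
    simpa using this.tendsto 0
  have hlarge : ∀ᶠ k : ℕ in atTop, √(Real.exp ((k : ℝ) ^ (-(1 / 2 - c))) - 1) < ε :=
    (hlim.comp ((tendsto_rpow_neg_atTop hη).comp tendsto_natCast_atTop_atTop)).eventually
      (gt_mem_nhds hε)
  -- P is fixed before n, so the thresholds on n in the bounded regime may depend on it.
  obtain ⟨P, hP⟩ := eventually_atTop.mp hlarge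
  have hdiv : ∀ C : ℝ, Tendsto (fun n : ℕ => C / n) atTop (𝓝 0) :=
    tendsto_const_div_atTop_nhds_zero_nat
  have h1 : 0 < (1 - ζ ^ 2) * M₁ ^ 2 := by
    have : 0 < ζ := (inv_pos.mpr (by linarith)).trans hζ
    have : 0 < 1 - ζ ^ 2 := by nlinarith
    positivity
  have hn3 : ∀ᶠ n : ℕ in atTop, √(Real.exp (2 * (16 * P ^ 4 * M / κ ^ 2) / n) - 1) < ε :=
    (hlim.comp (hdiv _)).eventually (gt_mem_nhds hε)
  filter_upwards [hsn, hs, hsp, eventually_gt_atTop 0, (hdiv (16 * P ^ 4 * M)).eventually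
    (gt_mem_nhds h1), (hdiv (16 * P ^ 4 * M / κ ^ 2)).eventually
    (gt_mem_nhds (show (0 : ℝ) < 1 / 2 by norm_num)), hn3] with n hsn hs hsp hn hn1 hn2 hn3 ψ hψ θ hθ
  rcases le_total P (p n) with hpP | hpP
  · have := power_le_of_large_dimension hM hM₁ hM₂ hζ hζ' hκ hκ' hc hn hsn hs hsp hψ hθ
    linarith [hP (p n) hpP]
  · have := power_le_of_bounded_dimension hM hM₁ hM₂ hζ hζ' hκ hκ' hc hn hsn hs hsp hpP hn1.le
      hn2.le hψ hθ
    linarith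

/-! ### Maximal power and its upper limit -/

section MaxPower

variable {p n : ℕ}

lemma power_nonneg {ψ : (Fin n → Obs p) → ℝ} (hψ : ∀ D, 0 ≤ ψ D ∧ ψ D ≤ 1) (θ : Param p) :
    0 ≤ power ψ θ := integral_nonneg fun D => (hψ D).1

lemma power_const (α : ℝ) (θ : Param p) : power (fun _ : Fin n → Obs p => α) θ = α := by
  simp [power, dataLaw]

lemma const_mem_tests {α : ℝ} (h0 : 0 ≤ α) (h1 : α ≤ 1) (Θ₁ : Set (Param p)) :
    (fun _ => α) ∈ tests n α Θ₁ :=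
  ⟨measurable_const, fun _ => ⟨h0, h1⟩, fun θ _ => (power_const α θ).le⟩

lemma maxPower_nonneg (α : ℝ) (Θ₁ Θ₂ : Set (Param p)) : 0 ≤ maxPower n α Θ₁ Θ₂ := by
  refine Real.sSup_nonneg ?_
  rintro x ⟨ψ, hψ, θ, -, rfl⟩
  exact power_nonneg hψ.2.1 θ

lemma maxPower_le {α B : ℝ} {Θ₁ Θ₂ : Set (Param p)} (hB : 0 ≤ B)
    (h : ∀ ψ ∈ tests n α Θ₁, ∀ θ ∈ Θ₂, power ψ θ ≤ B) : maxPower n α Θ₁ Θ₂ ≤ B := by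
  refine Real.sSup_le ?_ hB
  rintro x ⟨ψ, hψ, θ, hθ, rfl⟩
  exact h ψ hψ θ hθ

/-- The constant test has power α everywhere. The bound B is needed because the real `sSup` of an
unbounded set is 0. -/
lemma le_maxPower {α B : ℝ} {Θ₁ Θ₂ : Set (Param p)} (h0 : 0 ≤ α) (h1 : α ≤ 1)
    (hΘ : Θ₂.Nonempty) (h : ∀ ψ ∈ tests n α Θ₁, ∀ θ ∈ Θ₂, power ψ θ ≤ B) :
    α ≤ maxPower n α Θ₁ Θ₂ := by
  obtain ⟨θ, hθ⟩ := hΘ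
  refine le_csSup ⟨B, ?_⟩ ⟨_, const_mem_tests h0 h1 Θ₁, θ, hθ, (power_const α θ).symm⟩
  rintro x ⟨ψ, hψ, η, hη, rfl⟩
  exact h ψ hψ η hη

end MaxPower

/-- A real `limsup` is meaningful only under boundedness; nonnegativity supplies the coboundedness
used here. -/
lemma limsup_le_of_forall_eventually_le {u : ℕ → ℝ} {α : ℝ} (h0 : ∀ n, 0 ≤ u n)
    (h : ∀ ε > 0, ∀ᶠ n in atTop, u n ≤ α + ε) : limsup u atTop ≤ α := by
  refine le_of_forall_pos_le_add fun ε hε => ?_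
  exact limsup_le_of_le (isBoundedUnder_of ⟨0, h0⟩ :
    IsBoundedUnder (· ≥ ·) atTop u).isCoboundedUnder_le (h ε hε)

end UniformNonTestability

end

theorem theorem2
    (M M₁ M₂ ζ κ c α β₀ : ℝ)
    (hM : 1 < M) (hM₁ : 0 < M₁) (hM₂ : 0 < M₂)
    (hζ : M⁻¹ < ζ) (hζ' : ζ < 1) (hκ : 0 < κ) (hκ' : κ < ζ * M₁)
    (hc : c < 1 / 2) (hα : 0 < α) (hα' : α < 1)
    (p s : ℕ → ℕ)
    (hsn : ∀ᶠ n : ℕ in Filter.atTop, (s n : ℝ) * Real.log (p n) / n ≤ 1 / 4)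
    (hs : ∀ᶠ n : ℕ in Filter.atTop, 2 ≤ s n)
    (hsp : ∀ᶠ n : ℕ in Filter.atTop, (s n : ℝ) ≤ (p n : ℝ) ^ c) :
    let Θ₁ : (n : ℕ) → Set (UniformNonTestability.Param (p n)) := fun n =>
      UniformNonTestability.nullSpace (p n) M M₁ M₂ (s n) β₀
    let Θ₂ : (n : ℕ) → Set (UniformNonTestability.Param (p n)) := fun n =>
      UniformNonTestability.altSpace (p n) M M₁ M₂ ζ κ ((s n : ℝ) / 2) β₀
        (UniformNonTestability.radius M M₁ M₂ ζ κ c (s n) (p n) n)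
    UniformNonTestability.AsympUniformlyNonTestable α p Θ₁ Θ₂ ∧
    Filter.limsup (fun n => UniformNonTestability.maxPower n α (Θ₁ n) (Θ₂ n)) Filter.atTop ≤ α ∧
    ((∃ᶠ n in Filter.atTop, (Θ₂ n).Nonempty) →
      Filter.limsup (fun n => UniformNonTestability.maxPower n α (Θ₁ n) (Θ₂ n)) Filter.atTop
        = α) := by
  intro Θ₁ Θ₂
  have key : ∀ ε > 0, ∀ᶠ n : ℕ in Filter.atTop,
      ∀ ψ ∈ UniformNonTestability.tests n α (Θ₁ n), ∀ θ ∈ Θ₂ n,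
        UniformNonTestability.power ψ θ ≤ α + ε := fun ε hε =>
    UniformNonTestability.eventually_power_le hM hM₁ hM₂ hζ hζ' hκ hκ' hc hsn hs hsp hε
  have hle : Filter.limsup (fun n => UniformNonTestability.maxPower n α (Θ₁ n) (Θ₂ n))
      Filter.atTop ≤ α := by
    refine UniformNonTestability.limsup_le_of_forall_eventually_le
      (fun n => UniformNonTestability.maxPower_nonneg α _ _) fun ε hε => ?_
    filter_upwards [key ε hε] with n hn
    exact UniformNonTestability.maxPower_le (by linarith) hn
  refine ⟨fun ψ hψ => ?_, hle, fun hfreq => le_antisymm hle ?_⟩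
  · refine UniformNonTestability.limsup_le_of_forall_eventually_le (fun n => ?_) fun ε hε => ?_
    · refine Real.sSup_nonneg ?_
      rintro x ⟨θ, -, rfl⟩
      exact UniformNonTestability.power_nonneg (hψ n).2.1 θ
    · filter_upwards [key ε hε] with n hn
      refine Real.sSup_le ?_ (by linarith)
      rintro x ⟨θ, hθ, rfl⟩
      exact hn (ψ n) (hψ n) θ hθ
  -- The uniform power bound with ε = 1 supplies both the boundedness of the sequence and the upper
  -- bound for each supremum.
  · have hbdd : Filter.IsBoundedUnder (· ≤ ·) Filter.atTop
        (fun n => UniformNonTestability.maxPower n α (Θ₁ n) (Θ₂ n)) := by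
      refine ⟨α + 1, ?_⟩
      rw [Filter.eventually_map]
      filter_upwards [key 1 one_pos] with n hn
      exact UniformNonTestability.maxPower_le (by linarith) hn
    refine Filter.le_limsup_of_frequently_le ?_ hbdd
    exact (hfreq.and_eventually (key 1 one_pos)).mono fun n hn =>
      UniformNonTestability.le_maxPower hα.le hα'.le hn.1 hn.2
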